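/- Let $X$ be a string of $n$ independent uniform random bits, and let $Y$ be obtained from $X$ by deleting each bit independently with probability $\beta$; $D$ is the deletion pattern. Put $L_S=\lceil 1/\beta\rceil$, let $L_P$ be an integer with $11+2\log_2\frac1\beta\le L_P\le C\log_2\frac1\beta$ for a fixed constant $C$, let $k=\lfloor (n+L_P)/(L_S+L_P)\rfloor$, and write $X=S_1,P_1,S_2,P_2,\dots,S_{k-1},P_{k-1},S_k$ with pivots $|P_i|=L_P$ and segments $|S_i|=L_S$ (the last segment also takes the fewer than $L_S+L_P$ bits that may be left over). For an index $a$ of $X$ let $f_D(a)$ be the number of undeleted bits among $X(1),\dots,X(a)$, and let $\check p_i,\hat p_i$ be the first and the last index of $P_i$ in $X$. A copy of $P_i$ in $Y$ is a correct match of $P_i$ if either no bit of $P_i$ is deleted and the copy occupies the indices from $f_D(\check p_i)$ to $f_D(\hat p_i)$, or exactly one bit of $P_i$ is deleted and the copy begins at $f_D(\check p_i)$ or ends at $f_D(\hat p_i)$. Every other copy is an incorrect match; with two or more deletions in $P_i$ all copies are incorrect. A matching module is a deterministic function that receives $P_1,\dots,P_{k-1}$ and $Y$ (but neither $D$ nor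 the rest of $X$) and assigns to some of the pivots ("matches" them to) exact copies of them in $Y$, pairwise disjoint and in the order of the pivots. **Theorem.** For every $C$ there are functions $g(\beta)=o(\beta)$ and $e(\beta)=o(\beta)$ as $\beta\to0^+$ and a $\beta_0>0$ such that for every $0<\beta<\beta_0$ there are $c>0$ and $n_0$ such that for all $n\ge n_0$ and all $L_P$ as above there are an integer $k'$ with $|k'-(1-L_P\beta+2\beta)k|\le g(\beta)k$ and a matching module with the following properties. 1. With probability at least $1-2^{-cn}$ the module matches exactly $k'-1$ of the pivots, and at most a fraction $\beta+e(\beta)$ of the matched pivots is matched to an incorrect match. 2. For every single $i\in\{1,\dots,k-1\}$, the probability that $P_i$ is matched to an incorrect match is at most $\beta+e(\beta)$. -/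

import Mathlib

open Filter Topology Asymptotics

/-! Binary strings are lists of `Bool`. Positions inside strings are counted from `0`, unless a
comment says otherwise. A file `X` has `n` bits, and a deletion pattern `D` has `D j = true` exactly
when bit `j` is deleted. -/

/-- The output of the deletion channel on input `X` with deletion pattern `D`. -/
def channelOutput {n : ℕ} (X D : Fin n → Bool) : List Bool :=
  ((List.finRange n).filter (fun j => !D j)).map X

/-- The index map `f_D` of a deletion pattern: the index, counted from `1`, in the output string of
the last undeleted bit of the input at or before bit `j` (and `0` if there is none). For an
undeleted bit this is the index of the bit itself in the output. -/
def outIndex {n : ℕ} (D : Fin n → Bool) (j : ℕ) : ℕ :=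
  (Finset.univ.filter (fun l : Fin n => (l : ℕ) ≤ j ∧ D l = false)).card

/-- The length `L_S = 1 / β` of the segment strings, rounded up to an integer. -/
noncomputable def segLength (β : ℝ) : ℕ := ⌈1 / β⌉₊

/-- The number `k` of segment strings in a file of length `n`: the largest `k` with
`k * LS + (k - 1) * LP ≤ n`. There are `k - 1` pivots. -/
def numSegments (n LS LP : ℕ) : ℕ := (n + LP) / (LS + LP)

/-- The first bit of pivot `i` (pivots are counted from `0`) in
`X = S, P, S, P, …, S, P, S` with segments of length `LS` and pivots of length `LP`. -/
def pivotStart (LS LP i : ℕ) : ℕ := (i + 1) * LS + i * LP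

/-- Pivot `i` of the file `X`. -/
def pivot {n : ℕ} (LS LP : ℕ) (X : Fin n → Bool) (i : ℕ) : List Bool :=
  ((List.ofFn X).drop (pivotStart LS LP i)).take LP

/-- There is an exact copy of `P` in `Y` that is preceded by exactly `q` bits of `Y`. -/
def IsCopyAt (P Y : List Bool) (q : ℕ) : Prop := P <+: Y.drop q

/-- The number of deleted bits within pivot `i`. -/
def pivotDeletions {n : ℕ} (LS LP : ℕ) (D : Fin n → Bool) (i : ℕ) : ℕ :=
  (Finset.univ.filter (fun l : Fin n =>
    pivotStart LS LP i ≤ (l : ℕ) ∧ (l : ℕ) < pivotStart LS LP i + LP ∧ D l = true)).card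

/-- The copy of pivot `i` that is preceded by `q` bits of the channel output (so that it occupies
the indices `q + 1, …, q + LP`, counted from `1`) is a correct match of pivot `i`.
With no deletion within the pivot this is the image of the pivot itself; with one deletion it is a
copy that begins at the `f_D`-index of the first bit of the pivot or ends at the `f_D`-index of its
last bit; with more deletions no copy is a correct match. -/
def IsCorrectMatch {n : ℕ} (LS LP : ℕ) (X D : Fin n → Bool) (i q : ℕ) : Prop :=
  IsCopyAt (pivot LS LP X i) (channelOutput X D) q ∧
    ((pivotDeletions LS LP D i = 0 ∧
        q + 1 = outIndex D (pivotStart LS LP i) ∧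
        q + LP = outIndex D (pivotStart LS LP i + LP - 1)) ∨
      (pivotDeletions LS LP D i = 1 ∧
        (q + 1 = outIndex D (pivotStart LS LP i) ∨
          q + LP = outIndex D (pivotStart LS LP i + LP - 1))))

/-- A (deterministic) matching module for `N` pivots. From the pivot strings and the string `Y` only,
it assigns to some of the pivots a place in `Y`. Each pivot so matched is matched to an exact copy of
itself, and the matched copies are disjoint and occur in the order of the pivots, so that they
partition `Y` as `F₁, P_{i₁}, F₂, P_{i₂}, …`. -/
structure MatchingModule (N : ℕ) where
  place : (Fin N → List Bool) → List Bool → Fin N → Option ℕ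
  copy : ∀ (P : Fin N → List Bool) (Y : List Bool) (i : Fin N) (q : ℕ),
    place P Y i = some q → IsCopyAt (P i) Y q
  ordered : ∀ (P : Fin N → List Bool) (Y : List Bool) (i j : Fin N) (q r : ℕ), i < j →
    place P Y i = some q → place P Y j = some r → q + (P i).length ≤ r

/-- The answer of a matching module, for pivot `i`, when the file is `X` and the deletion pattern is
`D`. -/
def MatchingModule.answer {N n : ℕ} (M : MatchingModule N) (LS LP : ℕ) (X D : Fin n → Bool)
    (i : Fin N) : Option ℕ :=
  M.place (fun j => pivot LS LP X j) (channelOutput X D) i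

/-- Pivot `i` is matched, at a place that is not a correct match. -/
def MatchingModule.WrongAt {N n : ℕ} (M : MatchingModule N) (LS LP : ℕ) (X D : Fin n → Bool)
    (i : Fin N) : Prop :=
  ∃ q, M.answer LS LP X D i = some q ∧ ¬ IsCorrectMatch LS LP X D i q

/-- The number of matched pivots. -/
noncomputable def MatchingModule.numMatched {N n : ℕ} (M : MatchingModule N) (LS LP : ℕ)
    (X D : Fin n → Bool) : ℕ :=
  {i : Fin N | ∃ q, M.answer LS LP X D i = some q}.ncard

/-- The number of wrongly matched pivots. -/
noncomputable def MatchingModule.numWrong {N n : ℕ} (M : MatchingModule N) (LS LP : ℕ)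
    (X D : Fin n → Bool) : ℕ :=
  {i : Fin N | M.WrongAt LS LP X D i}.ncard

open Classical in
/-- The probability of an event, when the `n` bits of `X` are independent and uniform, and each bit
of `X` is deleted, independently of everything else, with probability `β`. -/
noncomputable def channelProb (n : ℕ) (β : ℝ) (E : (Fin n → Bool) → (Fin n → Bool) → Prop) : ℝ :=
  ∑ X : Fin n → Bool, ∑ D : Fin n → Bool,
    if E X D then (1 / 2 : ℝ) ^ n * ∏ j, (if D j = true then β else 1 - β) else 0

/-! The module takes an order-preserving matching of pivots to disjoint copies with as many pairs as
possible (`maxMatching`) and discards pairs until exactly `k' - 1` remain. It must be shown that the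
maximum is large and that few of its pairs are wrong. Below, `L` is the pivot length and `LS` the
segment length.

Size. The window of a pivot consists of the pivot and its two neighbouring bits; windows are
disjoint. A pivot has a copy inside the image of its window if none of its bits is deleted, or if
exactly one is deleted and a run of equal bits leads from it to just beyond an end of the pivot,
since a shift by one inside a run is invisible. The first case has probability `(1 - β) ^ L`, the
second about `2 * β`, one `β` per end. Such copies together form a matching, and a Chernoff bound
over the independent windows gives about `(1 - L * β + 2 * β) * k` pairs
(`channelProb_few_local_copies_le`).

Errors. Pivots with two or more deletions have probability of order `(L * β) ^ 2`, which is
negligible against `β`. The other wrongly matched pivots are called strays. Let `T` be a set of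
pivots without correct matches, cut off from the remaining pivots by correct matches, and let `B` be
the strays in `T`. Replacing the matching inside `T` by the true images of the pivots with undamaged
windows cannot enlarge a maximum matching; hence the deletions in the windows of `T` number at least
`(T \ B).card` (`card_sub_strays_le_deletions`).

For fixed `D`, the strays of `T` lie in a range of order `T.card / β` places. No bit of a stray copy
is the corresponding bit of its pivot, so given places impose `L` independent equations on `X` per
stray (`card_inputs_with_copies_le`). Up to constants, a pattern `(T, B)` therefore costs a factor
`L * β` for each point of `T \ B` and `2 ^ (-L) / β`, a small multiple of `β`, for each stray
(`channelProb_strayPattern_le`). Summing over patterns gives geometric series around the points of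
`B`, which yields an exponential tail bound for the number of strays
(`channelProb_card_stray_ge_le`) and a bound for a single pivot (`channelProb_strayAt_le`). -/

namespace PivotMatching

/-- The number of undeleted bits before bit `j`. -/
def rank {n : ℕ} (D : Fin n → Bool) (j : ℕ) : ℕ :=
  (Finset.univ.filter (fun l : Fin n => (l : ℕ) < j ∧ D l = false)).card

/-- The number of deleted bits in `[a, b)`. -/
def dels {n : ℕ} (D : Fin n → Bool) (a b : ℕ) : ℕ :=
  (Finset.univ.filter (fun l : Fin n => a ≤ (l : ℕ) ∧ (l : ℕ) < b ∧ D l = true)).card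

/-- The bits with index in `[a, b)`. -/
def bitRange (n a b : ℕ) : Finset (Fin n) :=
  Finset.univ.filter (fun l : Fin n => a ≤ (l : ℕ) ∧ (l : ℕ) < b)

theorem mem_bitRange {n a b : ℕ} {l : Fin n} :
    l ∈ bitRange n a b ↔ a ≤ (l : ℕ) ∧ (l : ℕ) < b := by
  simp [bitRange]

theorem card_bitRange_le (n a b : ℕ) : (bitRange n a b).card ≤ b - a := by
  rw [← Finset.card_map Fin.valEmbedding, ← Nat.card_Ico]
  refine Finset.card_le_card fun x hx => ?_
  obtain ⟨l, hl, rfl⟩ := Finset.mem_map.mp hx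
  exact Finset.mem_Ico.mpr (mem_bitRange.mp hl)

theorem card_bitRange {n a b : ℕ} (hb : b ≤ n) : (bitRange n a b).card = b - a := by
  refine le_antisymm (card_bitRange_le n a b) ?_
  rw [← Finset.card_map Fin.valEmbedding, ← Nat.card_Ico]
  refine Finset.card_le_card fun x hx => ?_
  rw [Finset.mem_Ico] at hx
  exact Finset.mem_map.mpr ⟨⟨x, by omega⟩, mem_bitRange.mpr hx, rfl⟩

/-! ### Ranks of bits and numbers of deletions. -/

section Rank

variable {n : ℕ} (D : Fin n → Bool)

theorem outIndex_eq_rank (j : ℕ) : outIndex D j = rank D (j + 1) := by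
  unfold outIndex rank
  congr 1
  ext l
  simp

theorem rank_mono {a b : ℕ} (h : a ≤ b) : rank D a ≤ rank D b := by
  unfold rank
  apply Finset.card_le_card
  intro l
  simp only [Finset.mem_filter, Finset.mem_univ, true_and]
  rintro ⟨h1, h2⟩
  exact ⟨by omega, h2⟩

theorem rank_zero : rank D 0 = 0 := by
  simp [rank]

theorem rank_add_dels {a b : ℕ} (hab : a ≤ b) (hb : b ≤ n) :
    rank D b + dels D a b = rank D a + (b - a) := by
  have h1 : rank D b = rank D a +
      (Finset.univ.filter (fun l : Fin n => a ≤ (l : ℕ) ∧ (l : ℕ) < b ∧ D l = false)).card := by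
    unfold rank
    rw [← Finset.card_union_of_disjoint]
    · congr 1
      ext l
      simp only [Finset.mem_filter, Finset.mem_univ, true_and, Finset.mem_union]
      constructor
      · rintro ⟨h1, h2⟩
        by_cases h : (l : ℕ) < a
        · exact Or.inl ⟨h, h2⟩
        · exact Or.inr ⟨by omega, h1, h2⟩
      · rintro (⟨h1, h2⟩ | ⟨h1, h2, h3⟩)
        · exact ⟨by omega, h2⟩
        · exact ⟨h2, h3⟩
    · rw [Finset.disjoint_left]
      intro l
      simp only [Finset.mem_filter, Finset.mem_univ, true_and]
      omega
  have h2 : (Finset.univ.filter (fun l : Fin n => a ≤ (l : ℕ) ∧ (l : ℕ) < b ∧ D l = false)).card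
      + dels D a b = b - a := by
    unfold dels
    rw [← Finset.card_union_of_disjoint]
    · have : (Finset.univ.filter (fun l : Fin n => a ≤ (l : ℕ) ∧ (l : ℕ) < b ∧ D l = false)) ∪
        (Finset.univ.filter (fun l : Fin n => a ≤ (l : ℕ) ∧ (l : ℕ) < b ∧ D l = true)) =
        bitRange n a b := by
        ext l
        simp only [Finset.mem_filter, Finset.mem_univ, true_and, Finset.mem_union, mem_bitRange]
        cases D l <;> simp
      rw [this, card_bitRange hb]
    · rw [Finset.disjoint_left]
      intro l
      simp only [Finset.mem_filter, Finset.mem_univ, true_and]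
      rintro ⟨_, _, h⟩ ⟨_, _, h'⟩
      simp [h] at h'
  omega

theorem rank_eq_of_le {j : ℕ} (hj : n ≤ j) : rank D j = rank D n := by
  unfold rank
  congr 1
  ext l
  have := l.2
  simp only [Finset.mem_filter, Finset.mem_univ, true_and]
  constructor <;> rintro ⟨_, h⟩ <;> exact ⟨by omega, h⟩

theorem rank_le_add {a b : ℕ} (hab : a ≤ b) : rank D b ≤ rank D a + (b - a) := by
  rcases le_total b n with hb | hb
  · have := rank_add_dels D hab hb
    omega
  · rw [rank_eq_of_le D hb]
    rcases le_total a n with ha | ha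
    · have := rank_add_dels D ha le_rfl
      omega
    · rw [rank_eq_of_le D ha]
      omega

theorem dels_add {a b c : ℕ} (hab : a ≤ b) (hbc : b ≤ c) :
    dels D a c = dels D a b + dels D b c := by
  unfold dels
  rw [← Finset.card_union_of_disjoint]
  · congr 1
    ext l
    simp only [Finset.mem_filter, Finset.mem_univ, true_and, Finset.mem_union]
    constructor
    · rintro ⟨h1, h2, h3⟩
      by_cases h : (l : ℕ) < b
      · exact Or.inl ⟨h1, h, h3⟩
      · exact Or.inr ⟨by omega, h2, h3⟩
    · rintro (⟨h1, h2, h3⟩ | ⟨h1, h2, h3⟩)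
      · exact ⟨h1, by omega, h3⟩
      · exact ⟨by omega, h2, h3⟩
  · rw [Finset.disjoint_left]
    intro l
    simp only [Finset.mem_filter, Finset.mem_univ, true_and]
    omega

theorem dels_eq_zero_iff {a b : ℕ} :
    dels D a b = 0 ↔ ∀ l : Fin n, a ≤ (l : ℕ) → (l : ℕ) < b → D l = false := by
  unfold dels
  rw [Finset.card_eq_zero, Finset.filter_eq_empty_iff]
  constructor
  · intro h l h1 h2
    have := @h l (Finset.mem_univ _)
    simpa [h1, h2] using this
  · rintro h l - ⟨h1, h2, h3⟩
    simp [h l h1 h2] at h3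

theorem rank_succ_of_kept {v : Fin n} (hv : D v = false) : rank D (v + 1) = rank D v + 1 := by
  have h := rank_add_dels D (Nat.le_succ (v : ℕ)) v.2
  have h0 : dels D v (v + 1) = 0 := by
    rw [dels_eq_zero_iff]
    intro l h1 h2
    have : l = v := Fin.ext (by omega)
    rw [this, hv]
  simp only [Nat.succ_eq_add_one] at h
  omega

theorem lt_of_rank_lt {a b : ℕ} (h : rank D a < rank D b) : a < b := by
  by_contra hh
  have := rank_mono D (not_lt.mp hh)
  omega

theorem kept_eq_of_rank_eq {v w : Fin n} (hv : D v = false) (hw : D w = false)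
    (h : rank D v = rank D w) : v = w := by
  rcases lt_trichotomy (v : ℕ) w with hlt | heq | hlt
  · have := rank_mono D (show (v : ℕ) + 1 ≤ w from hlt)
    rw [rank_succ_of_kept D hv] at this
    omega
  · exact Fin.ext heq
  · have := rank_mono D (show (w : ℕ) + 1 ≤ v from hlt)
    rw [rank_succ_of_kept D hw] at this
    omega

end Rank

/-! ### Copies of pivots in the channel output. -/

section Output

variable {n : ℕ}

/-- Exactly `rank D v` kept bits precede `v`, so cutting the list of indices at `v` shows the place
of `v` among the kept bits. This translates places in the output into ranks of input bits. -/
theorem kept_getElem?_rank (D : Fin n → Bool) {v : Fin n} (hv : D v = false) :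
    ((List.finRange n).filter (fun j => !D j))[rank D v]? = some v := by
  have hsplit : List.finRange n =
      (List.finRange n).take v ++ v :: (List.finRange n).drop (v + 1) := by
    conv_lhs => rw [← List.take_append_drop (v : ℕ) (List.finRange n)]
    congr 1
    rw [List.drop_eq_getElem_cons (by simp)]
    simp
  have hlen : (((List.finRange n).take v).filter (fun j => !D j)).length = rank D v := by
    have hnd : (((List.finRange n).take v).filter (fun j => !D j)).Nodup :=
      ((List.nodup_finRange n).sublist (List.take_sublist _ _)).filter _
    rw [← List.toFinset_card_of_nodup hnd]
    unfold rank
    congr 1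
    ext l
    simp only [List.mem_toFinset, List.mem_filter, Finset.mem_filter, Finset.mem_univ, true_and,
      Bool.not_eq_true', List.mem_take_iff_getElem]
    constructor
    · rintro ⟨⟨k, hk, rfl⟩, h2⟩
      simp at hk
      exact ⟨by simp; omega, h2⟩
    · rintro ⟨h1, h2⟩
      exact ⟨⟨l, by simpa using h1, by simp⟩, h2⟩
  rw [hsplit, List.filter_append, List.getElem?_append_right (by rw [hlen]), hlen]
  simp [hv]

theorem kept_getElem?_eq_some_iff (D : Fin n → Bool) {v : Fin n} {q : ℕ} :
    ((List.finRange n).filter (fun j => !D j))[q]? = some v ↔ D v = false ∧ rank D v = q := by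
  constructor
  · intro h
    have hmem := List.mem_of_getElem? h
    have hv : D v = false := by simpa using hmem
    refine ⟨hv, ?_⟩
    have h2 := kept_getElem?_rank D hv
    have hnd : ((List.finRange n).filter (fun j => !D j)).Nodup :=
      (List.nodup_finRange n).filter _
    have hq : q < ((List.finRange n).filter (fun j => !D j)).length := by
      by_contra hh
      rw [List.getElem?_eq_none (not_lt.mp hh)] at h
      simp at h
    exact ((List.getElem?_inj hq hnd).mp (h.trans h2.symm)).symm
  · rintro ⟨h1, rfl⟩
    exact kept_getElem?_rank D h1

theorem channelOutput_getElem?_eq_some_iff (X D : Fin n → Bool) {q : ℕ} {x : Bool} :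
    (channelOutput X D)[q]? = some x ↔ ∃ v, D v = false ∧ rank D v = q ∧ X v = x := by
  unfold channelOutput
  rw [List.getElem?_map]
  simp only [Option.map_eq_some_iff, kept_getElem?_eq_some_iff, and_assoc]

theorem isCopyAt_iff (P Y : List Bool) (q : ℕ) :
    IsCopyAt P Y q ↔ ∀ s < P.length, Y[q + s]? = P[s]? := by
  unfold IsCopyAt
  rw [List.prefix_iff_getElem?]
  simp only [List.getElem?_drop]
  constructor
  · intro h s hs
    rw [h s hs, List.getElem?_eq_getElem hs]
  · intro h s hs
    rw [h s hs, List.getElem?_eq_getElem hs]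

theorem pivot_length {LS LP i : ℕ} (X : Fin n → Bool) (h : pivotStart LS LP i + LP ≤ n) :
    (pivot LS LP X i).length = LP := by
  unfold pivot
  simp
  omega

theorem pivot_getElem? {LS LP i : ℕ} (X : Fin n → Bool) {w : Fin n}
    (h1 : pivotStart LS LP i ≤ w) (h2 : (w : ℕ) < pivotStart LS LP i + LP) :
    (pivot LS LP X i)[(w : ℕ) - pivotStart LS LP i]? = some (X w) := by
  unfold pivot
  rw [List.getElem?_take_of_lt (by omega), List.getElem?_drop]
  have : pivotStart LS LP i + ((w : ℕ) - pivotStart LS LP i) = w := by omega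
  rw [this]
  simp

/-- A copy of a pivot in the channel output, in terms of the bits of the input. -/
theorem isCopyAt_pivot_iff {LS LP i q : ℕ} (X D : Fin n → Bool)
    (h : pivotStart LS LP i + LP ≤ n) :
    IsCopyAt (pivot LS LP X i) (channelOutput X D) q ↔
      ∀ w : Fin n, pivotStart LS LP i ≤ w → (w : ℕ) < pivotStart LS LP i + LP →
        ∃ v, D v = false ∧ rank D v + pivotStart LS LP i = q + w ∧ X v = X w := by
  rw [isCopyAt_iff, pivot_length X h]
  constructor
  · intro hs w h1 h2
    have := hs ((w : ℕ) - pivotStart LS LP i) (by omega)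
    rw [pivot_getElem? X h1 h2, channelOutput_getElem?_eq_some_iff] at this
    obtain ⟨v, hv, hr, hx⟩ := this
    exact ⟨v, hv, by omega, hx⟩
  · intro hw s hs
    have hlt : pivotStart LS LP i + s < n := by omega
    obtain ⟨v, hv, hr, hx⟩ := hw ⟨pivotStart LS LP i + s, hlt⟩ (by simp) (by simpa using hs)
    have hp := pivot_getElem? (LS := LS) (LP := LP) (i := i) X
      (w := ⟨pivotStart LS LP i + s, hlt⟩) (by simp) (by simpa using hs)
    have e : pivotStart LS LP i + s - pivotStart LS LP i = s := by omega
    simp only [e] at hp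
    rw [hp, channelOutput_getElem?_eq_some_iff]
    simp only at hr
    exact ⟨v, hv, by omega, hx⟩

theorem pivotDeletions_eq_dels (LS LP : ℕ) (D : Fin n → Bool) (i : ℕ) :
    pivotDeletions LS LP D i = dels D (pivotStart LS LP i) (pivotStart LS LP i + LP) := rfl

/-- A copy of a pivot with at most one deletion is correct as soon as one of its bits is the image
of the corresponding bit of the pivot. -/
theorem isCorrectMatch_of_aligned {LS LP i q : ℕ} {X D : Fin n → Bool}
    (h : pivotStart LS LP i + LP ≤ n)
    (hcopy : IsCopyAt (pivot LS LP X i) (channelOutput X D) q)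
    (hdel : pivotDeletions LS LP D i ≤ 1) {w : Fin n}
    (h1 : pivotStart LS LP i ≤ w) (h2 : (w : ℕ) < pivotStart LS LP i + LP)
    (hw : D w = false) (hr : rank D w + pivotStart LS LP i = q + w) :
    IsCorrectMatch LS LP X D i q := by
  refine ⟨hcopy, ?_⟩
  rw [pivotDeletions_eq_dels] at *
  rw [outIndex_eq_rank, outIndex_eq_rank]
  set p := pivotStart LS LP i
  have e : p + LP - 1 + 1 = p + LP := by omega
  rw [e]
  have d1 := dels_add D h1 h2.le
  have r1 := rank_add_dels D h1 w.2.le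
  have r2 := rank_add_dels D h2.le h
  have r3 := rank_add_dels D (show p ≤ p + 1 by omega) (by omega)
  have left : dels D p w = 0 → q + 1 = rank D (p + 1) := by
    intro h0
    have : dels D p (p + 1) = 0 := by
      rw [dels_eq_zero_iff] at h0 ⊢
      intro l hl1 hl2
      rcases eq_or_lt_of_le h1 with hh | hh
      · have : l = w := Fin.ext (by omega)
        rw [this, hw]
      · exact h0 l hl1 (by omega)
    omega
  by_cases hz : dels D p (p + LP) = 0
  · left
    refine ⟨hz, left (by omega), by omega⟩
  · right
    -- The single deletion lies on one side of `w`; on the other side the alignment at `w`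
    -- propagates to the end of the pivot.
    refine ⟨by omega, ?_⟩
    by_cases h0 : dels D p w = 0
    · exact Or.inl (left h0)
    · right
      omega

/-- The slack of one is needed: if the first bit of the pivot is the deleted one, its `f_D`-index is
that of the preceding kept bit, so a correct match may start one place before the image of the
pivot. -/
theorem rank_start_le_of_isCorrectMatch {LS LP i q : ℕ} {X D : Fin n → Bool} (hL : 1 ≤ LP)
    (h : pivotStart LS LP i + LP ≤ n) (hc : IsCorrectMatch LS LP X D i q) :
    rank D (pivotStart LS LP i) ≤ q + 1 := by
  obtain ⟨-, hc⟩ := hc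
  rw [outIndex_eq_rank, outIndex_eq_rank, pivotDeletions_eq_dels] at hc
  set p := pivotStart LS LP i
  have e : p + LP - 1 + 1 = p + LP := by omega
  rw [e] at hc
  have r1 := rank_add_dels D (show p ≤ p + LP by omega) h
  have r2 := rank_mono D (show p ≤ p + 1 by omega)
  omega

/-- With one deletion the image of the pivot has length `LP - 1`, so a correct match that begins
where the image begins overshoots its end by one. -/
theorem le_rank_end_of_isCorrectMatch {LS LP i q : ℕ} {X D : Fin n → Bool} (hL : 1 ≤ LP)
    (h : pivotStart LS LP i + LP ≤ n) (hc : IsCorrectMatch LS LP X D i q) :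
    q + LP ≤ rank D (pivotStart LS LP i + LP) + 1 := by
  obtain ⟨-, hc⟩ := hc
  rw [outIndex_eq_rank, outIndex_eq_rank, pivotDeletions_eq_dels] at hc
  set p := pivotStart LS LP i
  have e : p + LP - 1 + 1 = p + LP := by omega
  rw [e] at hc
  have r1 := rank_add_dels D (show p ≤ p + LP by omega) h
  have r2 := rank_le_add D (show p ≤ p + 1 by omega)
  omega

/-- A pivot without deletions has a copy at its own image. -/
theorem isCopyAt_rank_of_dels_eq_zero {LS LP i : ℕ} {X D : Fin n → Bool}
    (h : pivotStart LS LP i + LP ≤ n)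
    (h0 : dels D (pivotStart LS LP i) (pivotStart LS LP i + LP) = 0) :
    IsCopyAt (pivot LS LP X i) (channelOutput X D) (rank D (pivotStart LS LP i)) := by
  rw [isCopyAt_pivot_iff X D h]
  intro w h1 h2
  have d := dels_add D h1 h2.le
  have r := rank_add_dels D h1 w.2.le
  exact ⟨w, (dels_eq_zero_iff D).mp h0 w h1 h2, by omega, rfl⟩

end Output

/-! ### Product measures, independence and a Chernoff bound. -/

section ProductExpectation

variable {ι α : Type*} [Fintype ι] [DecidableEq ι] [Fintype α]

/-- Expectation with respect to the product weight `∏ v, p (ω v)`. -/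
noncomputable def prodExp (p : α → ℝ) (f : (ι → α) → ℝ) : ℝ :=
  ∑ ω : ι → α, (∏ v, p (ω v)) * f ω

theorem prodExp_prod (p : α → ℝ) (h : ι → α → ℝ) :
    prodExp p (fun ω => ∏ v, h v (ω v)) = ∏ v, ∑ a, p a * h v a := by
  unfold prodExp
  simp_rw [← Finset.prod_mul_distrib]
  rw [Finset.prod_univ_sum, Fintype.piFinset_univ]

theorem prodExp_one {p : α → ℝ} (hp : ∑ a, p a = 1) :
    prodExp p (fun _ : ι → α => (1 : ℝ)) = 1 := by
  have := prodExp_prod (ι := ι) p (fun _ _ => 1)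
  simpa [hp] using this

theorem prodExp_mono {p : α → ℝ} (hp : ∀ a, 0 ≤ p a) {f g : (ι → α) → ℝ} (h : ∀ ω, f ω ≤ g ω) :
    prodExp p f ≤ prodExp p g :=
  Finset.sum_le_sum fun ω _ =>
    mul_le_mul_of_nonneg_left (h ω) (Finset.prod_nonneg fun _ _ => hp _)

theorem prodExp_nonneg {p : α → ℝ} (hp : ∀ a, 0 ≤ p a) {f : (ι → α) → ℝ} (h : ∀ ω, 0 ≤ f ω) :
    0 ≤ prodExp p f :=
  Finset.sum_nonneg fun ω _ => mul_nonneg (Finset.prod_nonneg fun _ _ => hp _) (h ω)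

theorem prodExp_add (p : α → ℝ) (f g : (ι → α) → ℝ) :
    prodExp p (fun ω => f ω + g ω) = prodExp p f + prodExp p g := by
  simp [prodExp, mul_add, Finset.sum_add_distrib]

theorem prodExp_const_mul (p : α → ℝ) (c : ℝ) (f : (ι → α) → ℝ) :
    prodExp p (fun ω => c * f ω) = c * prodExp p f := by
  simp only [prodExp, Finset.mul_sum]
  exact Finset.sum_congr rfl fun _ _ => by ring

theorem prodExp_sum {κ : Type*} (p : α → ℝ) (s : Finset κ) (f : κ → (ι → α) → ℝ) :
    prodExp p (fun ω => ∑ k ∈ s, f k ω) = ∑ k ∈ s, prodExp p (f k) := by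
  simp only [prodExp, Finset.mul_sum]
  exact Finset.sum_comm

/-- Exchanging the coordinates outside of `J` between two configurations. -/
def mergeEquiv (J : Finset ι) : ((ι → α) × (ι → α)) ≃ ((ι → α) × (ι → α)) where
  toFun w := (fun v => if v ∈ J then w.1 v else w.2 v, fun v => if v ∈ J then w.2 v else w.1 v)
  invFun w := (fun v => if v ∈ J then w.1 v else w.2 v, fun v => if v ∈ J then w.2 v else w.1 v)
  left_inv w := by
    ext v <;> by_cases h : v ∈ J <;> simp [h]
  right_inv w := by
    ext v <;> by_cases h : v ∈ J <;> simp [h]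

/-- The product of expectations is an expectation over two independent configurations. Exchanging
their coordinates outside `J` preserves the weight, and afterwards both functions are read off the
same configuration. -/
theorem prodExp_mul_of_dependsOn {p : α → ℝ} (hp : ∑ a, p a = 1) {f g : (ι → α) → ℝ}
    {J : Finset ι} (hf : DependsOn f (J : Set ι)) (hg : DependsOn g ((J : Set ι)ᶜ)) :
    prodExp p (fun ω => f ω * g ω) = prodExp p f * prodExp p g := by
  have h1 : prodExp p f * prodExp p g =
      ∑ w : (ι → α) × (ι → α), ((∏ v, p (w.1 v)) * (∏ v, p (w.2 v))) * (f w.1 * g w.2) := by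
    unfold prodExp
    rw [Finset.sum_mul_sum, ← Finset.univ_product_univ, Finset.sum_product]
    exact Finset.sum_congr rfl fun _ _ => Finset.sum_congr rfl fun _ _ => by ring
  have h2 : prodExp p (fun ω => f ω * g ω) =
      ∑ w : (ι → α) × (ι → α), ((∏ v, p (w.1 v)) * (∏ v, p (w.2 v))) * (f w.1 * g w.1) := by
    conv_lhs => rw [← mul_one (prodExp p _), ← prodExp_one (ι := ι) hp]
    unfold prodExp
    rw [Finset.sum_mul_sum, ← Finset.univ_product_univ, Finset.sum_product]
    exact Finset.sum_congr rfl fun _ _ => Finset.sum_congr rfl fun _ _ => by ring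
  rw [h1, h2]
  symm
  apply Fintype.sum_equiv (mergeEquiv J)
  rintro ⟨x, y⟩
  have hw : (∏ v, p (x v)) * (∏ v, p (y v)) =
      (∏ v, p ((mergeEquiv J (x, y)).1 v)) * (∏ v, p ((mergeEquiv J (x, y)).2 v)) := by
    rw [← Finset.prod_mul_distrib, ← Finset.prod_mul_distrib]
    refine Finset.prod_congr rfl fun v _ => ?_
    by_cases h : v ∈ J <;> simp [mergeEquiv, h, mul_comm]
  have ef : f x = f (mergeEquiv J (x, y)).1 := by
    apply hf
    intro v hv
    have : v ∈ J := hv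
    simp [mergeEquiv, this]
  have eg : g y = g (mergeEquiv J (x, y)).1 := by
    apply hg
    intro v hv
    have : v ∉ J := hv
    simp [mergeEquiv, this]
  simp only [hw, ← ef, ← eg]

theorem prodExp_prod_of_dependsOn {κ : Type*} [DecidableEq κ] {p : α → ℝ} (hp : ∑ a, p a = 1)
    (s : Finset κ) (f : κ → (ι → α) → ℝ) (J : κ → Finset ι)
    (hf : ∀ k ∈ s, DependsOn (f k) (J k : Set ι))
    (hJ : ∀ k ∈ s, ∀ l ∈ s, k ≠ l → Disjoint (J k) (J l)) :
    prodExp p (fun ω => ∏ k ∈ s, f k ω) = ∏ k ∈ s, prodExp p (f k) := by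
  induction s using Finset.induction_on with
  | empty => simpa using prodExp_one hp
  | insert a s ha ih =>
    simp_rw [Finset.prod_insert ha]
    rw [prodExp_mul_of_dependsOn hp (hf a (Finset.mem_insert_self _ _)), ih]
    · exact fun k hk => hf k (Finset.mem_insert_of_mem hk)
    · exact fun k hk l hl => hJ k (Finset.mem_insert_of_mem hk) l (Finset.mem_insert_of_mem hl)
    · intro x y hxy
      refine Finset.prod_congr rfl fun k hk => hf k (Finset.mem_insert_of_mem hk) fun i hi => ?_
      apply hxy
      have := hJ k (Finset.mem_insert_of_mem hk) a (Finset.mem_insert_self _ _)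
        (fun h => ha (h ▸ hk))
      exact fun hia => Finset.disjoint_left.mp this hi hia

open Classical in
/-- A Chernoff bound for events that depend on disjoint sets of coordinates. -/
theorem prodExp_card_ge_le {κ : Type*} [Fintype κ] {p : α → ℝ} (hp0 : ∀ a, 0 ≤ p a)
    (hp : ∑ a, p a = 1) (A : κ → (ι → α) → Prop) (J : κ → Finset ι)
    (hA : ∀ k, DependsOn (A k) (J k : Set ι))
    (hJ : ∀ k l, k ≠ l → Disjoint (J k) (J l)) {q δ : ℝ} (hq1 : q ≤ 1)
    (hδ0 : 0 < δ) (hδ1 : δ ≤ 1)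
    (hAq : ∀ k, prodExp p (fun ω => if A k ω then (1 : ℝ) else 0) ≤ q) :
    prodExp p (fun ω => if (q + δ) * Fintype.card κ ≤
        ((Finset.univ.filter (fun k => A k ω)).card : ℝ) then (1 : ℝ) else 0)
      ≤ Real.exp (-(Fintype.card κ * δ ^ 2 / 4)) := by
  -- This value minimizes the final exponent `s ^ 2 - s * δ` per event, giving `-δ ^ 2 / 4`.
  set s := δ / 2 with hs
  set N : ℝ := (Fintype.card κ : ℝ) with hN
  have hN0 : 0 ≤ N := by positivity
  have hpt : ∀ ω, (if (q + δ) * N ≤ ((Finset.univ.filter (fun k => A k ω)).card : ℝ)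
      then (1 : ℝ) else 0) ≤ Real.exp (-(s * ((q + δ) * N))) *
        ∏ k, (if A k ω then Real.exp s else 1) := by
    intro ω
    have hprod : ∏ k, (if A k ω then Real.exp s else 1) =
        Real.exp (s * ((Finset.univ.filter (fun k => A k ω)).card : ℝ)) := by
      rw [Finset.prod_ite]
      simp [← Real.exp_nat_mul, mul_comm]
    rw [hprod, ← Real.exp_add]
    split_ifs with h
    · rw [Real.one_le_exp_iff]
      have : 0 ≤ s * (((Finset.univ.filter (fun k => A k ω)).card : ℝ) - (q + δ) * N) :=
        mul_nonneg (by positivity) (by linarith)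
      linarith
    · exact (Real.exp_pos _).le
  refine (prodExp_mono hp0 hpt).trans ?_
  rw [prodExp_const_mul, prodExp_prod_of_dependsOn hp Finset.univ
    (fun k ω => if A k ω then Real.exp s else 1) J]
  · have hone : ∀ k, prodExp p (fun ω => if A k ω then Real.exp s else 1)
        ≤ Real.exp (q * s + s ^ 2) := by
      intro k
      have : (fun ω => if A k ω then Real.exp s else (1 : ℝ)) =
          fun ω => 1 + (Real.exp s - 1) * (if A k ω then (1 : ℝ) else 0) := by
        funext ω
        split_ifs <;> ring
      rw [this, prodExp_add, prodExp_one hp, prodExp_const_mul]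
      have hs0 : 0 ≤ s := by positivity
      have hs1 : s ≤ 1 := by rw [hs]; linarith
      have h1 : Real.exp s - 1 ≤ s + s ^ 2 := by
        have := Real.abs_exp_sub_one_sub_id_le (x := s) (by rwa [abs_of_nonneg hs0])
        have := (abs_le.mp this).2
        linarith
      have h0 : 0 ≤ Real.exp s - 1 := by
        have := Real.add_one_le_exp s
        linarith
      have hq0 : 0 ≤ q := (prodExp_nonneg hp0 (fun ω => by split_ifs <;> norm_num)).trans (hAq k)
      calc 1 + (Real.exp s - 1) * prodExp p (fun ω => if A k ω then (1 : ℝ) else 0)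
          ≤ 1 + (s + s ^ 2) * q :=
            add_le_add le_rfl (mul_le_mul h1 (hAq k)
              (prodExp_nonneg hp0 fun ω => by split_ifs <;> norm_num) (by positivity))
        _ ≤ 1 + (q * s + s ^ 2) := by nlinarith [sq_nonneg s]
        _ ≤ _ := by
            rw [add_comm]
            exact Real.add_one_le_exp _
    calc Real.exp (-(s * ((q + δ) * N))) * ∏ k, prodExp p (fun ω => if A k ω then Real.exp s else 1)
        ≤ Real.exp (-(s * ((q + δ) * N))) * ∏ _k : κ, Real.exp (q * s + s ^ 2) := by
          gcongr with k _
          · exact fun k _ => prodExp_nonneg hp0 fun ω => by split_ifs <;> positivity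
          · exact hone k
      _ = Real.exp (-(N * δ ^ 2 / 4)) := by
          rw [Finset.prod_const, ← Real.exp_nat_mul, ← Real.exp_add, Finset.card_univ, ← hN]
          congr 1
          rw [hs]
          ring
  · intro k _ x y hxy
    have := hA k hxy
    simp only [this]
  · exact fun k _ l _ => hJ k l

end ProductExpectation

/-! ### The channel as a product measure on pairs of a bit and a deletion flag. -/

section ChannelProb

variable {n : ℕ}

/-- The weight of one bit of the input together with its deletion flag. -/
noncomputable def bitWeight (β : ℝ) (a : Bool × Bool) : ℝ :=
  1 / 2 * (if a.2 = true then β else 1 - β)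

theorem bitWeight_nonneg {β : ℝ} (h0 : 0 ≤ β) (h1 : β ≤ 1) (a : Bool × Bool) :
    0 ≤ bitWeight β a := by
  unfold bitWeight
  split_ifs <;> linarith

theorem sum_bitWeight (β : ℝ) : ∑ a, bitWeight β a = 1 := by
  simp [bitWeight, Fintype.sum_prod_type]

open Classical in
theorem channelProb_eq_prodExp (β : ℝ) (E : (Fin n → Bool) → (Fin n → Bool) → Prop) :
    channelProb n β E = prodExp (bitWeight β) (fun ω : Fin n → Bool × Bool =>
      if E (fun v => (ω v).1) (fun v => (ω v).2) then (1 : ℝ) else 0) := by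
  unfold channelProb prodExp
  rw [← Finset.sum_product', Finset.univ_product_univ]
  symm
  apply Fintype.sum_equiv (Equiv.arrowProdEquivProdArrow (Fin n) (fun _ => Bool) (fun _ => Bool))
  intro ω
  simp only [Equiv.arrowProdEquivProdArrow, Equiv.coe_fn_mk, bitWeight, Finset.prod_mul_distrib,
    Finset.prod_const, Finset.card_univ, Fintype.card_fin]
  by_cases hE : E (fun v => (ω v).1) (fun v => (ω v).2)
  · simp only [hE, if_true, mul_one]
    congr 1
  · simp [hE]

theorem channelProb_le_sum {κ : Type*} {β : ℝ} (h0 : 0 ≤ β) (h1 : β ≤ 1) (s : Finset κ)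
    {E : (Fin n → Bool) → (Fin n → Bool) → Prop}
    {F : κ → (Fin n → Bool) → (Fin n → Bool) → Prop}
    (h : ∀ X D, E X D → ∃ k ∈ s, F k X D) :
    channelProb n β E ≤ ∑ k ∈ s, channelProb n β (F k) := by
  classical
  simp only [channelProb_eq_prodExp]
  rw [← prodExp_sum]
  refine prodExp_mono (bitWeight_nonneg h0 h1) fun ω => ?_
  have hnn : ∀ k ∈ s, (0 : ℝ) ≤ if F k (fun v => (ω v).1) (fun v => (ω v).2) then 1 else 0 :=
    fun k _ => by split_ifs <;> norm_num
  split_ifs with hE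
  · obtain ⟨k, hk, hF⟩ := h _ _ hE
    refine le_trans ?_ (Finset.single_le_sum hnn hk)
    simp [hF]
  · exact Finset.sum_nonneg hnn

theorem channelProb_le_add {β : ℝ} (h0 : 0 ≤ β) (h1 : β ≤ 1)
    {E F G : (Fin n → Bool) → (Fin n → Bool) → Prop} (h : ∀ X D, E X D → F X D ∨ G X D) :
    channelProb n β E ≤ channelProb n β F + channelProb n β G := by
  have := channelProb_le_sum h0 h1 (Finset.univ : Finset Bool) (E := E)
    (F := fun b => if b then F else G) (fun X D hE => by
      rcases h X D hE with hF | hG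
      · exact ⟨true, Finset.mem_univ _, by simpa using hF⟩
      · exact ⟨false, Finset.mem_univ _, by simpa using hG⟩)
  simpa using this

theorem one_le_channelProb_add_not (β : ℝ) (E : (Fin n → Bool) → (Fin n → Bool) → Prop) :
    channelProb n β E + channelProb n β (fun X D => ¬ E X D) = 1 := by
  classical
  rw [channelProb_eq_prodExp, channelProb_eq_prodExp, ← prodExp_add]
  refine Eq.trans ?_ (prodExp_one (ι := Fin n) (sum_bitWeight β))
  congr 1
  funext ω
  by_cases hE : E (fun v => (ω v).1) (fun v => (ω v).2) <;> simp [hE]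

/-- The expectation of a power of the number of deletions in a set of bits. -/
theorem sum_weight_mul_pow_card (β y : ℝ) (J : Finset (Fin n)) :
    ∑ D : Fin n → Bool, (∏ j, (if D j = true then β else 1 - β)) *
      y ^ (J.filter (fun j => D j = true)).card = (1 - β + β * y) ^ J.card := by
  have h := prodExp_prod (ι := Fin n) (fun d : Bool => if d = true then β else 1 - β)
    (fun j d => if j ∈ J then (if d = true then y else 1) else 1)
  unfold prodExp at h
  have e1 : ∀ D : Fin n → Bool, ∏ j, (if j ∈ J then (if D j = true then y else 1) else 1) =
      y ^ (J.filter (fun j => D j = true)).card := by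
    intro D
    rw [Finset.prod_ite_mem, Finset.univ_inter, Finset.prod_ite]
    simp
  simp only [e1] at h
  rw [h]
  have e2 : ∀ j : Fin n, ∑ a : Bool, (if a = true then β else 1 - β) *
      (if j ∈ J then (if a = true then y else 1) else 1) =
      if j ∈ J then (1 - β + β * y) else 1 := by
    intro j
    by_cases hj : j ∈ J <;> simp [hj]
    ring
  simp only [e2]
  rw [Finset.prod_ite_mem, Finset.univ_inter, Finset.prod_const]

end ChannelProb

/-! ### Maximum matchings and their truncation. -/

section MaxMatching

variable {N : ℕ}

/-- An order-preserving matching of some of the pivots to disjoint copies. -/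
structure IsMatching (P : Fin N → List Bool) (Y : List Bool) (m : Fin N → Option ℕ) : Prop where
  copy : ∀ i q, m i = some q → IsCopyAt (P i) Y q
  ordered : ∀ i j q r, i < j → m i = some q → m j = some r → q + (P i).length ≤ r

/-- The set of matched pivots. -/
def matchedSet (m : Fin N → Option ℕ) : Finset (Fin N) :=
  Finset.univ.filter (fun i => (m i).isSome)

theorem mem_matchedSet {m : Fin N → Option ℕ} {i : Fin N} :
    i ∈ matchedSet m ↔ ∃ q, m i = some q := by
  simp [matchedSet, Option.isSome_iff_exists]

theorem exists_max_matching (P : Fin N → List Bool) (Y : List Bool) :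
    ∃ m, IsMatching P Y m ∧
      ∀ m', IsMatching P Y m' → (matchedSet m').card ≤ (matchedSet m).card := by
  classical
  set S : Set ℕ := {c | ∃ m, IsMatching P Y m ∧ (matchedSet m).card = c}
  have hne : S.Nonempty := ⟨_, fun _ => none, ⟨by simp, by simp⟩, rfl⟩
  have hbd : BddAbove S := by
    refine ⟨N, ?_⟩
    rintro c ⟨m, -, rfl⟩
    simpa using Finset.card_le_univ (matchedSet m)
  obtain ⟨m, hm, hc⟩ := Nat.sSup_mem hne hbd
  exact ⟨m, hm, fun m' hm' => hc ▸ le_csSup hbd ⟨m', hm', rfl⟩⟩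

/-- A matching with the largest possible number of matched pivots. -/
noncomputable def maxMatching (P : Fin N → List Bool) (Y : List Bool) : Fin N → Option ℕ :=
  (exists_max_matching P Y).choose

theorem maxMatching_isMatching (P : Fin N → List Bool) (Y : List Bool) :
    IsMatching P Y (maxMatching P Y) :=
  (exists_max_matching P Y).choose_spec.1

theorem card_le_card_maxMatching {P : Fin N → List Bool} {Y : List Bool} {m : Fin N → Option ℕ}
    (hm : IsMatching P Y m) : (matchedSet m).card ≤ (matchedSet (maxMatching P Y)).card :=
  (exists_max_matching P Y).choose_spec.2 m hm

/-- The number of matched pivots has to be exact; discarding pairs achieves this without creating a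
wrong one. -/
theorem exists_truncation (K : ℕ) (m : Fin N → Option ℕ) :
    ∃ m' : Fin N → Option ℕ, (∀ i q, m' i = some q → m i = some q) ∧
      (K ≤ (matchedSet m).card → (matchedSet m').card = K) := by
  classical
  by_cases h : K ≤ (matchedSet m).card
  · obtain ⟨S, hS, hcard⟩ := Finset.exists_subset_card_eq h
    refine ⟨fun i => if i ∈ S then m i else none, ?_, fun _ => ?_⟩
    · intro i q hq
      by_cases hi : i ∈ S <;> simp_all
    · rw [← hcard]
      congr 1
      ext i
      rw [mem_matchedSet]
      by_cases hi : i ∈ S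
      · simpa [hi] using mem_matchedSet.mp (hS hi)
      · simp [hi]
  · exact ⟨m, fun _ _ h => h, fun h' => absurd h' h⟩

/-- A maximum matching, of which only `K` pairs are kept. -/
noncomputable def truncatedMax (K : ℕ) (P : Fin N → List Bool) (Y : List Bool) :
    Fin N → Option ℕ :=
  (exists_truncation K (maxMatching P Y)).choose

theorem truncatedMax_eq_some {K : ℕ} {P : Fin N → List Bool} {Y : List Bool} {i : Fin N} {q : ℕ}
    (h : truncatedMax K P Y i = some q) : maxMatching P Y i = some q :=
  (exists_truncation K (maxMatching P Y)).choose_spec.1 i q h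

theorem card_matchedSet_truncatedMax {K : ℕ} {P : Fin N → List Bool} {Y : List Bool}
    (h : K ≤ (matchedSet (maxMatching P Y)).card) :
    (matchedSet (truncatedMax K P Y)).card = K :=
  (exists_truncation K (maxMatching P Y)).choose_spec.2 h

/-- The matching module that keeps `K` pairs of a maximum matching. -/
noncomputable def maxModule (N K : ℕ) : MatchingModule N where
  place := truncatedMax K
  copy P Y i q h := (maxMatching_isMatching P Y).copy i q (truncatedMax_eq_some h)
  ordered P Y i j q r hij hi hj :=
    (maxMatching_isMatching P Y).ordered i j q r hij (truncatedMax_eq_some hi)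
      (truncatedMax_eq_some hj)

end MaxMatching

/-! ### Positions of the pivots in the file. -/

/-- The numerical conditions on the decomposition of a file of length `n` into segments of length
`LS` and `N` pivots of length `L`. -/
structure Layout (n LS L N : ℕ) : Prop where
  two_le : 2 ≤ LS
  one_le : 1 ≤ L
  fit : ∀ i < N, pivotStart LS L i + L + LS ≤ n
  short : ∀ i, i + 1 = N → n ≤ pivotStart LS L i + 2 * (LS + L)

theorem pivotStart_succ (LS L i : ℕ) : pivotStart LS L (i + 1) = pivotStart LS L i + (LS + L) := by
  unfold pivotStart
  ring

theorem pivotStart_ge (LS L i : ℕ) : LS ≤ pivotStart LS L i := by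
  unfold pivotStart
  nlinarith [Nat.zero_le (i * LS), Nat.zero_le (i * L)]

theorem pivotStart_add_le {LS L i j : ℕ} (h : i < j) :
    pivotStart LS L i + (LS + L) ≤ pivotStart LS L j := by
  rw [← pivotStart_succ]
  unfold pivotStart
  have h' : i + 1 ≤ j := h
  have := Nat.mul_le_mul_right LS (Nat.succ_le_succ h')
  have := Nat.mul_le_mul_right L h'
  simp only [Nat.succ_eq_add_one] at *
  omega

/-! ### The exchange argument for isolated sets of pivots. -/

section Exchange

variable {n LS L N : ℕ}

/-- The matching of the pivots of `X` found in the output of the channel. -/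
noncomputable def answer (LS L N : ℕ) (X D : Fin n → Bool) : Fin N → Option ℕ :=
  maxMatching (fun j : Fin N => pivot LS L X j) (channelOutput X D)

/-- Pivot `i` is matched correctly by the maximum matching. -/
def CorrectAt (LS L N : ℕ) (X D : Fin n → Bool) (i : Fin N) : Prop :=
  ∃ q, answer LS L N X D i = some q ∧ IsCorrectMatch LS L X D i q

/-- Pivot `i` has at most one deletion and is matched incorrectly by the maximum matching. -/
def StrayAt (LS L N : ℕ) (X D : Fin n → Bool) (i : Fin N) : Prop :=
  ∃ q, answer LS L N X D i = some q ∧ ¬ IsCorrectMatch LS L X D i q ∧ pivotDeletions LS L D i ≤ 1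

/-- The bits of pivot `i` and the two adjacent bits. -/
def window (n LS L i : ℕ) : Finset (Fin n) :=
  bitRange n (pivotStart LS L i - 1) (pivotStart LS L i + L + 1)

theorem card_filter_window (D : Fin n → Bool) (i : ℕ) :
    ((window n LS L i).filter (fun l => D l = true)).card =
      dels D (pivotStart LS L i - 1) (pivotStart LS L i + L + 1) := by
  unfold window bitRange dels
  rw [Finset.filter_filter]
  simp only [and_assoc]

theorem card_window_le (i : ℕ) : (window n LS L i).card ≤ L + 2 :=
  (card_bitRange_le _ _ _).trans (by omega)

theorem disjoint_window (hLS : 2 ≤ LS) {i j : ℕ} (hij : i ≠ j) :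
    Disjoint (window n LS L i) (window n LS L j) := by
  rw [Finset.disjoint_left]
  intro l
  simp only [window, mem_bitRange]
  rcases lt_or_gt_of_ne hij with h | h
  · have := pivotStart_add_le (LS := LS) (L := L) h
    omega
  · have := pivotStart_add_le (LS := LS) (L := L) h
    omega

/-- Choosing a copy inside of the image of its window for each pivot of a set gives a matching. -/
theorem isMatching_of_window {X D : Fin n → Bool} (hl : Layout n LS L N) (m : Fin N → Option ℕ)
    (hcopy : ∀ i q, m i = some q → IsCopyAt (pivot LS L X i) (channelOutput X D) q)
    (hlo : ∀ i q, m i = some q → rank D (pivotStart LS L i - 1) ≤ q)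
    (hhi : ∀ i q, m i = some q → q + L ≤ rank D (pivotStart LS L i + L + 1)) :
    IsMatching (fun j : Fin N => pivot LS L X j) (channelOutput X D) m where
  copy := hcopy
  ordered i j q r hij hi hj := by
    have h1 := hl.fit i i.2
    have := hl.two_le
    rw [pivot_length X (by omega)]
    refine (hhi i q hi).trans (le_trans (rank_mono D ?_) (hlo j r hj))
    have := pivotStart_add_le (LS := LS) (L := L) (show (i : ℕ) < j from hij)
    omega

theorem ordered_answer (hl : Layout n LS L N) {X D : Fin n → Bool} {i j : Fin N} {q r : ℕ}
    (hij : i < j) (hi : answer LS L N X D i = some q) (hj : answer LS L N X D j = some r) :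
    q + L ≤ r := by
  have := (maxMatching_isMatching _ _).ordered i j q r hij hi hj
  rwa [pivot_length X (by have := hl.fit i i.2; omega)] at this

theorem copy_answer {X D : Fin n → Bool} {i : Fin N} {q : ℕ}
    (hi : answer LS L N X D i = some q) : IsCopyAt (pivot LS L X i) (channelOutput X D) q :=
  (maxMatching_isMatching _ _).copy i q hi

/-- `T` contains no correctly matched pivot, and it is separated by correctly matched pivots from
the pivots outside of it. -/
def Isolated (LS L N : ℕ) (X D : Fin n → Bool) (T : Finset (Fin N)) : Prop :=
  (∀ t ∈ T, ¬ CorrectAt LS L N X D t) ∧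
    ∀ t ∈ T, ∀ i ∉ T, ∃ c ∈ Set.uIcc t i, CorrectAt LS L N X D c

open Classical in
/-- Exchange argument: in an isolated set, a maximum matching matches at least as many pivots as
there are pivots without deletions in their windows. -/
theorem card_good_le_card_matched (hl : Layout n LS L N) {X D : Fin n → Bool}
    {T : Finset (Fin N)} (hT : Isolated LS L N X D T) :
    (T.filter (fun t : Fin N =>
        dels D (pivotStart LS L t - 1) (pivotStart LS L t + L + 1) = 0)).card ≤
      (T.filter (fun t => t ∈ matchedSet (answer LS L N X D))).card := by
  set G := fun t : Fin N => dels D (pivotStart LS L t - 1) (pivotStart LS L t + L + 1) = 0 with hG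
  set m := answer LS L N X D with hm
  -- The competitor: inside `T`, the pivots with undamaged windows go to their own images and all
  -- others stay unmatched; outside `T` nothing changes.
  set m' : Fin N → Option ℕ := fun i => if i ∈ T then
    (if G i then some (rank D (pivotStart LS L i)) else none) else m i with hm'
  have hone : ∀ i, G i → rank D (pivotStart LS L i - 1) + 1 = rank D (pivotStart LS L i) ∧
      rank D (pivotStart LS L i) + L + 1 = rank D (pivotStart LS L i + L + 1) ∧
      dels D (pivotStart LS L i) (pivotStart LS L i + L) = 0 := by
    intro i hi
    have h1 := hl.fit i i.2
    have h2 := hl.two_le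
    have h3 := pivotStart_ge LS L i
    have d1 := dels_add D (show pivotStart LS L i - 1 ≤ pivotStart LS L i by omega)
      (show pivotStart LS L i ≤ pivotStart LS L i + L + 1 by omega)
    have d2 := dels_add D (show pivotStart LS L i ≤ pivotStart LS L i + L by omega)
      (show pivotStart LS L i + L ≤ pivotStart LS L i + L + 1 by omega)
    have r1 := rank_add_dels D (show pivotStart LS L i - 1 ≤ pivotStart LS L i by omega) (by omega)
    have r2 := rank_add_dels D (show pivotStart LS L i ≤ pivotStart LS L i + L + 1 by omega)
      (by omega)
    simp only [hG] at hi
    omega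
  have hmatch : IsMatching (fun j : Fin N => pivot LS L X j) (channelOutput X D) m' := by
    constructor
    · intro i q hq
      by_cases hi : i ∈ T
      · by_cases hg : G i
        · simp only [hm', hi, hg, if_true, Option.some.injEq] at hq
          rw [← hq]
          exact isCopyAt_rank_of_dels_eq_zero (by have := hl.fit i i.2; omega) (hone i hg).2.2
        · simp [hm', hi, hg] at hq
      · simp only [hm', hi, if_false] at hq
        exact copy_answer hq
    · intro i j q r hij hi hj
      rw [pivot_length X (by have := hl.fit i i.2; omega)]
      have hgap := fun a b : Fin N => fun h : a < b =>
        pivotStart_add_le (LS := LS) (L := L) (show (a : ℕ) < b from h)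
      have h2 := hl.two_le
      by_cases hiT : i ∈ T
      · by_cases hgi : G i
        · simp only [hm', hiT, hgi, if_true, Option.some.injEq] at hi
          have hi1 := hone i hgi
          by_cases hjT : j ∈ T
          · by_cases hgj : G j
            · simp only [hm', hjT, hgj, if_true, Option.some.injEq] at hj
              have := rank_mono D (show pivotStart LS L i + L + 1 ≤ pivotStart LS L j by
                have := hgap i j hij; omega)
              omega
            · simp [hm', hjT, hgj] at hj
          · simp only [hm', hjT, if_false] at hj
            -- A correctly matched pivot `c` separates the two. Its copy starts at most one place
            -- before its image, and the kept bit just after pivot `i` absorbs this place.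
            obtain ⟨c, hc, s, hs, hcor⟩ := hT.2 i hiT j hjT
            rw [Set.uIcc_of_le hij.le] at hc
            have hic : i < c := lt_of_le_of_ne hc.1 (by
              rintro rfl
              exact hT.1 i hiT ⟨s, hs, hcor⟩)
            have hsr : s ≤ r := by
              rcases eq_or_lt_of_le hc.2 with h | h
              · subst h
                have : s = r := by
                  have := hs.symm.trans hj
                  simpa using this
                exact this.le
              · have := ordered_answer hl h hs hj
                omega
            have h5 := rank_start_le_of_isCorrectMatch hl.one_le
              (by have := hl.fit c c.2; omega) hcor
            have := rank_mono D (show pivotStart LS L i + L + 1 ≤ pivotStart LS L c by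
                have := hgap i c hic; omega)
            omega
        · simp [hm', hiT, hgi] at hi
      · simp only [hm', hiT, if_false] at hi
        by_cases hjT : j ∈ T
        · by_cases hgj : G j
          · simp only [hm', hjT, hgj, if_true, Option.some.injEq] at hj
            have hj1 := hone j hgj
            obtain ⟨c, hc, s, hs, hcor⟩ := hT.2 j hjT i hiT
            rw [Set.uIcc_of_ge hij.le] at hc
            have hcj : c < j := lt_of_le_of_ne hc.2 (by
              rintro rfl
              exact hT.1 c hjT ⟨s, hs, hcor⟩)
            have hsr : q ≤ s := by
              rcases eq_or_lt_of_le hc.1 with h | h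
              · subst h
                have : q = s := by
                  have := hi.symm.trans hs
                  simpa using this
                exact this.le
              · have := ordered_answer hl h hi hs
                omega
            have h5 := le_rank_end_of_isCorrectMatch hl.one_le (by have := hl.fit c c.2; omega) hcor
            have := rank_mono D (show pivotStart LS L c + L ≤ pivotStart LS L j - 1 by
                have := hgap c j hcj; omega)
            omega
          · simp [hm', hjT, hgj] at hj
        · simp only [hm', hjT, if_false] at hj
          exact ordered_answer hl hij hi hj
  -- The two matchings agree outside `T`, so maximality compares only what they match inside `T`.
  have hcard := card_le_card_maxMatching hmatch
  have hsplit : ∀ f : Fin N → Option ℕ, (matchedSet f).card =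
      (T.filter (fun t => t ∈ matchedSet f)).card +
        (Tᶜ.filter (fun t => t ∈ matchedSet f)).card := by
    intro f
    rw [← Finset.card_union_of_disjoint
      (Finset.disjoint_filter_filter disjoint_compl_right)]
    congr 1
    ext i
    by_cases hi : i ∈ T <;> simp [hi]
  have e1 : T.filter (fun t => t ∈ matchedSet m') = T.filter G := by
    refine Finset.filter_congr fun i hi => ?_
    rw [mem_matchedSet]
    by_cases hg : G i <;> simp [hm', hi, hg]
  have e2 : Tᶜ.filter (fun t => t ∈ matchedSet m') = Tᶜ.filter (fun t => t ∈ matchedSet m) := by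
    refine Finset.filter_congr fun i hi => ?_
    rw [Finset.mem_compl] at hi
    rw [mem_matchedSet, mem_matchedSet]
    simp [hm', hi]
  change (matchedSet m').card ≤ (matchedSet m).card at hcard
  rw [hsplit m', hsplit m, e1, e2] at hcard
  convert Nat.le_of_add_le_add_right hcard

open Classical in
/-- The pivots of an isolated set that are not strays are paid for by deletions. -/
theorem card_sub_strays_le_deletions (hl : Layout n LS L N) {X D : Fin n → Bool}
    {T : Finset (Fin N)} (hT : Isolated LS L N X D T) :
    T.card ≤ (T.filter (fun t => StrayAt LS L N X D t)).card +
      ((T.biUnion (fun t => window n LS L t)).filter (fun l => D l = true)).card := by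
  set κ := fun t : Fin N => dels D (pivotStart LS L t - 1) (pivotStart LS L t + L + 1) with hκ
  have hex := card_good_le_card_matched hl hT
  have hsum : ((T.biUnion (fun t => window n LS L t)).filter (fun l => D l = true)).card =
      ∑ t ∈ T, κ t := by
    rw [Finset.filter_biUnion, Finset.card_biUnion]
    · exact Finset.sum_congr rfl fun t _ => card_filter_window D t
    · intro s _ t _ hst
      exact Finset.disjoint_filter_filter (disjoint_window hl.two_le (fun h => hst (Fin.ext h)))
  have hmatched : (T.filter (fun t => t ∈ matchedSet (answer LS L N X D))).card ≤
      (T.filter (fun t => StrayAt LS L N X D t)).card + (T.filter (fun t => 2 ≤ κ t)).card := by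
    refine le_trans (Finset.card_le_card ?_) (Finset.card_union_le _ _)
    intro t
    simp only [Finset.mem_filter, Finset.mem_union, mem_matchedSet]
    rintro ⟨ht, q, hq⟩
    by_cases h2 : pivotDeletions LS L D t ≤ 1
    · exact Or.inl ⟨ht, q, hq, fun hc => hT.1 t ht ⟨q, hq, hc⟩, h2⟩
    · refine Or.inr ⟨ht, ?_⟩
      rw [pivotDeletions_eq_dels] at h2
      have d1 := dels_add D (show pivotStart LS L t - 1 ≤ pivotStart LS L t by omega)
        (show pivotStart LS L t ≤ pivotStart LS L t + L + 1 by omega)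
      have d2 := dels_add D (show pivotStart LS L t ≤ pivotStart LS L t + L by omega)
        (show pivotStart LS L t + L ≤ pivotStart LS L t + L + 1 by omega)
      simp only [hκ]
      omega
  -- Termwise, `1 + [2 ≤ κ] ≤ [κ = 0] + κ`: two deletions pay both for the window not being
  -- undamaged and for the pivot possibly being matched all the same.
  have hcount : T.card + (T.filter (fun t => 2 ≤ κ t)).card ≤
      (T.filter (fun t => κ t = 0)).card + ∑ t ∈ T, κ t := by
    rw [Finset.card_filter, Finset.card_filter, Finset.card_eq_sum_ones, ← Finset.sum_add_distrib,
      ← Finset.sum_add_distrib]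
    refine Finset.sum_le_sum fun t _ => ?_
    split_ifs <;> omega
  rw [hsum]
  simp only [hκ] at *
  omega

/-- The places in the output that the strays of an isolated set may occupy. -/
def strayRange (LS L : ℕ) (D : Fin n → Bool) (T : Finset (Fin N)) : Finset ℕ :=
  T.biUnion (fun t => Finset.Icc (rank D (pivotStart LS L t - (LS + L)) - 1)
    (rank D (pivotStart LS L t + 2 * (LS + L)) + 1))

theorem card_strayRange_le (D : Fin n → Bool) (T : Finset (Fin N)) :
    (strayRange LS L D T).card ≤ T.card * (3 * (LS + L) + 3) := by
  refine Finset.card_biUnion_le_card_mul _ _ _ fun t _ => ?_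
  rw [Nat.card_Icc]
  have := rank_le_add D (show pivotStart LS L t - (LS + L) ≤
    pivotStart LS L t + 2 * (LS + L) by omega)
  omega

/-- The order of the matching traps the copy. If it starts to the right of the image of pivot `i`,
let `j` be the last pivot of `T`, from `i` on, whose image begins no later than `q + 1`. The next
pivot either lies in `T`, and then its image begins beyond `q + 1`, or it is correctly matched,
since nothing else can separate it from `j`; then its copy, which is close to its image, comes after
the copy of `i`. The left side is symmetric. -/
theorem stray_mem_strayRange (hl : Layout n LS L N) {X D : Fin n → Bool}
    {T : Finset (Fin N)} (hT : Isolated LS L N X D T) {i : Fin N} (hi : i ∈ T) {q : ℕ}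
    (hq : answer LS L N X D i = some q) : q ∈ strayRange LS L D T := by
  classical
  simp only [strayRange, Finset.mem_biUnion, Finset.mem_Icc]
  have hlen : q ≤ rank D n := by
    have h1 := hl.fit i i.2
    have hL := hl.one_le
    have hp : pivotStart LS L i < n := by omega
    have := (isCopyAt_pivot_iff X D (by omega)).mp (copy_answer hq) ⟨pivotStart LS L i, hp⟩
      (by simp) (by simp; omega)
    obtain ⟨v, -, hv, -⟩ := this
    have := rank_mono D v.2.le
    simp only at hv
    omega
  rcases le_total (rank D (pivotStart LS L i)) q with hle | hle
  · set S := T.filter (fun j => i ≤ j ∧ rank D (pivotStart LS L j) ≤ q + 1) with hS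
    have hiS : i ∈ S := by
      simp only [hS, Finset.mem_filter]
      exact ⟨hi, le_rfl, by omega⟩
    obtain ⟨j, hjS, hjmax⟩ : ∃ j ∈ S, ∀ k ∈ S, k ≤ j :=
      ⟨S.max' ⟨i, hiS⟩, Finset.max'_mem _ _, fun k hk => Finset.le_max' _ _ hk⟩
    have hj := hjS
    simp only [hS, Finset.mem_filter] at hj
    obtain ⟨hjT, hij, hjr⟩ := hj
    refine ⟨j, hjT, ?_, ?_⟩
    · have := rank_mono D (show pivotStart LS L j - (LS + L) ≤ pivotStart LS L j by omega)
      omega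
    -- The range allotted to the last pivot reaches the end of the file, by `Layout.short`.
    · by_cases hend : (j : ℕ) + 1 = N
      · have := rank_mono D (hl.short j hend)
        omega
      · have hk : (j : ℕ) + 1 < N := by omega
        set k : Fin N := ⟨j + 1, hk⟩ with hkdef
        have hps : pivotStart LS L k = pivotStart LS L j + (LS + L) := pivotStart_succ _ _ _
        have hmono := rank_mono D (show pivotStart LS L k ≤ pivotStart LS L j + 2 * (LS + L) by
          omega)
        have hjk : j < k := Fin.lt_def.mpr (by simp [hkdef])
        by_cases hkT : k ∈ T
        · have : ¬ rank D (pivotStart LS L k) ≤ q + 1 := by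
            intro h
            have := hjmax k (by
              simp only [hS, Finset.mem_filter]
              exact ⟨hkT, hij.trans hjk.le, h⟩)
            exact absurd hjk (not_lt.mpr this)
          omega
        · obtain ⟨c, hc, s, hs, hcor⟩ := hT.2 j hjT k hkT
          rw [Set.uIcc_of_le hjk.le] at hc
          have hcj : c ≠ j := by
            rintro rfl
            exact hT.1 c hjT ⟨s, hs, hcor⟩
          have hck : c = k := by
            apply Fin.ext
            have h1 : (j : ℕ) ≤ c := hc.1
            have h2 : (c : ℕ) ≤ k := hc.2
            have h3 : (c : ℕ) ≠ j := fun h => hcj (Fin.ext h)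
            simp only [hkdef] at h2 ⊢
            omega
          subst hck
          have h6 := ordered_answer hl (lt_of_le_of_lt hij hjk) hq hs
          have h5 := le_rank_end_of_isCorrectMatch hl.one_le (by have := hl.fit k k.2; omega) hcor
          have h7 := rank_le_add D (show pivotStart LS L k ≤ pivotStart LS L k + L by omega)
          omega
  · set S := T.filter (fun j => j ≤ i ∧ q ≤ rank D (pivotStart LS L j) + 1) with hS
    have hiS : i ∈ S := by
      simp only [hS, Finset.mem_filter]
      exact ⟨hi, le_rfl, by omega⟩
    obtain ⟨j, hjS, hjmin⟩ : ∃ j ∈ S, ∀ k ∈ S, j ≤ k :=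
      ⟨S.min' ⟨i, hiS⟩, Finset.min'_mem _ _, fun k hk => Finset.min'_le _ _ hk⟩
    have hj := hjS
    simp only [hS, Finset.mem_filter] at hj
    obtain ⟨hjT, hij, hjr⟩ := hj
    refine ⟨j, hjT, ?_, ?_⟩
    · by_cases hend : (j : ℕ) = 0
      · have : pivotStart LS L j - (LS + L) = 0 := by
          rw [hend]
          simp [pivotStart]
        rw [this, rank_zero]
        omega
      · have hk : (j : ℕ) - 1 < N := by omega
        set k : Fin N := ⟨j - 1, hk⟩ with hkdef
        have hps : pivotStart LS L j = pivotStart LS L k + (LS + L) := by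
          rw [← pivotStart_succ]
          congr 1
          simp only [hkdef]
          omega
        have hlo : pivotStart LS L j - (LS + L) = pivotStart LS L k := by omega
        rw [hlo]
        have hjk : k < j := Fin.lt_def.mpr (by simp only [hkdef]; omega)
        by_cases hkT : k ∈ T
        · have : ¬ q ≤ rank D (pivotStart LS L k) + 1 := by
            intro h
            have := hjmin k (by
              simp only [hS, Finset.mem_filter]
              exact ⟨hkT, hjk.le.trans hij, h⟩)
            exact absurd hjk (not_lt.mpr this)
          omega
        · obtain ⟨c, hc, s, hs, hcor⟩ := hT.2 j hjT k hkT
          rw [Set.uIcc_of_ge hjk.le] at hc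
          have hcj : c ≠ j := by
            rintro rfl
            exact hT.1 c hjT ⟨s, hs, hcor⟩
          have hck : c = k := by
            apply Fin.ext
            have h1 : (k : ℕ) ≤ c := hc.1
            have h2 : (c : ℕ) ≤ j := hc.2
            have h3 : (c : ℕ) ≠ j := fun h => hcj (Fin.ext h)
            simp only [hkdef] at h1 ⊢
            omega
          subst hck
          have h6 := ordered_answer hl (lt_of_lt_of_le hjk hij) hs hq
          have h5 := rank_start_le_of_isCorrectMatch hl.one_le (by have := hl.fit k k.2; omega) hcor
          omega
    · have := rank_mono D (show pivotStart LS L j ≤ pivotStart LS L j + 2 * (LS + L) by omega)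
      omega

end Exchange

/-! ### Counting solutions and placements. -/

/-- A system of equations `X (φ v) = X v`, `v ∈ V`, with `φ` strictly increasing and without fixed
points, is independent. -/
theorem card_solutions_mul_le {n : ℕ} (V : Finset (Fin n)) (φ : Fin n → Fin n)
    (hmono : ∀ v ∈ V, ∀ w ∈ V, v < w → φ v < φ w) (hfix : ∀ v ∈ V, φ v ≠ v) :
    (Finset.univ.filter (fun X : Fin n → Bool => ∀ v ∈ V, X (φ v) = X v)).card * 2 ^ V.card
      ≤ 2 ^ n := by
  classical
  have hinj : (Finset.univ.filter (fun X : Fin n → Bool => ∀ v ∈ V, X (φ v) = X v)).card ≤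
      Fintype.card ({v // v ∈ Vᶜ} → Bool) := by
    refine Finset.card_le_card_of_injOn (fun X v => X v.1) (fun _ _ => Finset.mem_univ _) ?_
    intro X hX Y hY hXY
    simp only [Finset.coe_filter, Finset.mem_univ, true_and, Set.mem_ofPred_eq] at hX hY
    have hout : ∀ v, X v ≠ Y v → v ∈ V := by
      intro v hv
      by_contra h
      exact hv (congrFun hXY ⟨v, by simpa using h⟩)
    -- Two solutions that agree outside `V` but differ at a point differ along its whole `φ`-orbit.
    -- This orbit stays in `V` and is strictly monotone, which is impossible in a finite set. Hence
    -- the values outside `V` determine a solution.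
    have hstep : ∀ v, X v ≠ Y v → X (φ v) ≠ Y (φ v) := by
      intro v hv
      rw [hX v (hout v hv), hY v (hout v hv)]
      exact hv
    by_contra hne
    obtain ⟨u, hu⟩ := Function.ne_iff.mp hne
    rcases lt_or_gt_of_ne (hfix u (hout u hu)) with hlt | hgt
    · set S := Finset.univ.filter (fun v => X v ≠ Y v ∧ φ v < v) with hS
      have huS : u ∈ S := by simp [hS, hu, hlt]
      have hm := Finset.min'_mem S ⟨u, huS⟩
      set v := S.min' ⟨u, huS⟩ with hv
      simp only [hS, Finset.mem_filter, Finset.mem_univ, true_and] at hm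
      have h1 := hstep v hm.1
      have h2 := hmono _ (hout _ h1) _ (hout _ hm.1) hm.2
      have h3 : S.min' ⟨u, huS⟩ ≤ φ v := Finset.min'_le _ _ (by simp [hS, h1, h2])
      exact absurd hm.2 (not_lt.mpr h3)
    · set S := Finset.univ.filter (fun v => X v ≠ Y v ∧ v < φ v) with hS
      have huS : u ∈ S := Finset.mem_filter.mpr ⟨Finset.mem_univ _, hu, hgt⟩
      have hm := Finset.max'_mem S ⟨u, huS⟩
      set v := S.max' ⟨u, huS⟩ with hv
      simp only [hS, Finset.mem_filter, Finset.mem_univ, true_and] at hm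
      have h1 := hstep v hm.1
      have h2 := hmono _ (hout _ hm.1) _ (hout _ h1) hm.2
      have h3 : φ v ≤ S.max' ⟨u, huS⟩ := Finset.le_max' _ _ (by simp [hS, h1, h2])
      exact absurd hm.2 (not_lt.mpr h3)
  have hcard : Fintype.card ({v // v ∈ Vᶜ} → Bool) = 2 ^ (n - V.card) := by
    rw [Fintype.card_fun, Fintype.card_bool, Fintype.card_coe, Finset.card_compl, Fintype.card_fin]
  rw [hcard] at hinj
  have hV : V.card ≤ n := by simpa using Finset.card_le_univ V
  calc _ ≤ 2 ^ (n - V.card) * 2 ^ V.card := Nat.mul_le_mul_right _ hinj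
    _ = 2 ^ n := by rw [← pow_add, Nat.sub_add_cancel hV]

/-- A strictly increasing map is determined by its image. -/
theorem card_strictMono_le_choose {κ : Type*} [LinearOrder κ] [Fintype κ] (Q : Finset ℕ)
    (A : Finset (κ → ℕ)) (hA : ∀ q ∈ A, StrictMono q ∧ ∀ i, q i ∈ Q) :
    A.card ≤ Q.card.choose (Fintype.card κ) := by
  classical
  rw [← Finset.card_powersetCard]
  refine Finset.card_le_card_of_injOn (fun q => Finset.univ.image q) ?_ ?_
  · intro q hq
    obtain ⟨h1, h2⟩ := hA q hq
    simp only [Finset.mem_coe, Finset.mem_powersetCard]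
    refine ⟨fun x hx => ?_, ?_⟩
    · obtain ⟨i, -, rfl⟩ := Finset.mem_image.mp hx
      exact h2 i
    · rw [Finset.card_image_of_injective _ h1.injective, Finset.card_univ]
  · intro q hq r hr h
    have h1 := (hA q hq).1
    have h2 := (hA r hr).1
    rw [← StrictMono.range_inj h1 h2]
    have := congrArg (fun s : Finset ℕ => (s : Set ℕ)) h
    simpa using this

/-- This is one term of the expansion of `(β + 1) ^ Q`. It exchanges the number of placements for a
factor `1 / β` per stray and a factor that is exponential in `β * Q`. -/
theorem choose_mul_pow_le_exp {β : ℝ} (hβ : 0 ≤ β) (Q w : ℕ) :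
    (Q.choose w : ℝ) * β ^ w ≤ Real.exp (β * Q) := by
  have h1 : (Q.choose w : ℝ) * β ^ w ≤ (β + 1) ^ Q := by
    rw [add_pow]
    rcases le_or_gt w Q with h | h
    · have := Finset.single_le_sum (f := fun m => β ^ m * 1 ^ (Q - m) * (Q.choose m : ℝ))
        (s := Finset.range (Q + 1)) (fun m _ => by positivity)
        (Finset.mem_range.mpr (Nat.lt_succ_of_le h))
      simp only [one_pow, mul_one] at this ⊢
      linarith
    · rw [Nat.choose_eq_zero_of_lt h]
      simp only [Nat.cast_zero, zero_mul]
      positivity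
  refine h1.trans ?_
  calc (β + 1) ^ Q ≤ (Real.exp β) ^ Q := by
        gcongr
        exact Real.add_one_le_exp β
    _ = Real.exp (β * Q) := by rw [← Real.exp_nat_mul, mul_comm]

/-! ### The probability of a given pattern of strays. -/

section Stray

variable {n LS L N : ℕ}

theorem card_biUnion_pivots (hl : Layout n LS L N) (B : Finset (Fin N)) :
    (B.biUnion (fun i => bitRange n (pivotStart LS L i) (pivotStart LS L i + L))).card =
      B.card * L := by
  classical
  rw [Finset.card_biUnion]
  · rw [Finset.sum_const_nat]
    intro i _
    have hfit := hl.fit i i.2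
    rw [card_bitRange (by omega)]
    omega
  · intro i _ j _ hij
    rw [Function.onFun, Finset.disjoint_left]
    intro l
    simp only [mem_bitRange]
    rcases lt_or_gt_of_ne hij with h | h
    · have := pivotStart_add_le (LS := LS) (L := L) (show (i : ℕ) < j from h)
      omega
    · have := pivotStart_add_le (LS := LS) (L := L) (show (j : ℕ) < i from h)
      omega

open Classical in
/-- For given places of the strays, the strays impose independent equations on the input. -/
theorem card_inputs_with_copies_le (hl : Layout n LS L N) (D : Fin n → Bool)
    (B : Finset (Fin N)) (q : Fin N → ℕ)
    (hq : ∀ i ∈ B, ∀ j ∈ B, i < j → q i + L ≤ q j) :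
    (Finset.univ.filter (fun X : Fin n → Bool => ∀ i ∈ B, ∀ w : Fin n,
      pivotStart LS L i ≤ w → (w : ℕ) < pivotStart LS L i + L →
        ∃ v, v ≠ w ∧ D v = false ∧ rank D v + pivotStart LS L i = q i + w ∧ X v = X w)).card *
      2 ^ (L * B.card) ≤ 2 ^ n := by
  set F := Finset.univ.filter (fun X : Fin n → Bool => ∀ i ∈ B, ∀ w : Fin n,
      pivotStart LS L i ≤ w → (w : ℕ) < pivotStart LS L i + L →
        ∃ v, v ≠ w ∧ D v = false ∧ rank D v + pivotStart LS L i = q i + w ∧ X v = X w) with hF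
  -- A sample input `X₀` only serves to show that the required kept bits exist. Which bits they are
  -- depends on `D` and `q` alone, since a kept bit is determined by its rank; so all inputs in `F`
  -- satisfy one common system of equations.
  rcases F.eq_empty_or_nonempty with hE | ⟨X₀, hX₀⟩
  · simp [hE]
  set V := B.biUnion (fun i => bitRange n (pivotStart LS L i) (pivotStart LS L i + L)) with hV
  have hmemV : ∀ w, w ∈ V ↔ ∃ i ∈ B, pivotStart LS L i ≤ w ∧ (w : ℕ) < pivotStart LS L i + L := by
    intro w
    simp [hV, mem_bitRange]
  have hex : ∀ w : Fin n, ∃ v : Fin n, ∀ i ∈ B, pivotStart LS L i ≤ w →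
      (w : ℕ) < pivotStart LS L i + L →
      v ≠ w ∧ D v = false ∧ rank D v + pivotStart LS L i = q i + w := by
    intro w
    simp only [hF, Finset.mem_filter, Finset.mem_univ, true_and] at hX₀
    by_cases hw : w ∈ V
    · obtain ⟨i, hi, h1, h2⟩ := (hmemV w).mp hw
      obtain ⟨v, h3, h4, h5, -⟩ := hX₀ i hi w h1 h2
      refine ⟨v, fun j hj h6 h7 => ?_⟩
      have : j = i := by
        by_contra hne
        rcases lt_or_gt_of_ne hne with h | h
        · have := pivotStart_add_le (LS := LS) (L := L) (show (j : ℕ) < i from h)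
          omega
        · have := pivotStart_add_le (LS := LS) (L := L) (show (i : ℕ) < j from h)
          omega
      subst this
      exact ⟨h3, h4, h5⟩
    · exact ⟨w, fun i hi h1 h2 => absurd ((hmemV w).mpr ⟨i, hi, h1, h2⟩) hw⟩
  choose φ hφ using hex
  have hsub : F ⊆ Finset.univ.filter (fun X : Fin n → Bool => ∀ v ∈ V, X (φ v) = X v) := by
    intro X hX
    simp only [hF, Finset.mem_filter, Finset.mem_univ, true_and] at hX ⊢
    intro w hw
    obtain ⟨i, hi, h1, h2⟩ := (hmemV w).mp hw
    obtain ⟨v, -, h4, h5, h6⟩ := hX i hi w h1 h2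
    obtain ⟨-, h7, h8⟩ := hφ w i hi h1 h2
    rw [kept_eq_of_rank_eq D h7 h4 (by omega), h6]
  have hsol := card_solutions_mul_le V φ ?_ ?_
  · rw [card_biUnion_pivots hl B] at hsol
    rw [mul_comm L]
    exact (Nat.mul_le_mul_right _ (Finset.card_le_card hsub)).trans hsol
  · intro v hv w hw hvw
    obtain ⟨i, hi, h1, h2⟩ := (hmemV v).mp hv
    obtain ⟨j, hj, h3, h4⟩ := (hmemV w).mp hw
    obtain ⟨-, -, h5⟩ := hφ v i hi h1 h2
    obtain ⟨-, -, h6⟩ := hφ w j hj h3 h4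
    have hvw' : (v : ℕ) < w := hvw
    refine lt_of_rank_lt D ?_
    rcases lt_trichotomy i j with h | h | h
    · have := hq i hi j hj h
      omega
    · subst h
      omega
    · have := pivotStart_add_le (LS := LS) (L := L) (show (j : ℕ) < i from h)
      omega
  · intro v hv
    obtain ⟨i, hi, h1, h2⟩ := (hmemV v).mp hv
    exact (hφ v i hi h1 h2).1

/-- `T` is isolated, and `B` is the set of strays in it. -/
def StrayPattern (LS L N : ℕ) (T B : Finset (Fin N)) (X D : Fin n → Bool) : Prop :=
  Isolated LS L N X D T ∧ ∀ t ∈ T, StrayAt LS L N X D t ↔ t ∈ B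

-- Union bound over the placements of the strays for a fixed `D`: they are increasing and stay in
-- `strayRange`, so a binomial coefficient counts them, and each one imposes `L * B.card`
-- independent equations.
open Classical in
theorem card_strayPattern_mul_le (hl : Layout n LS L N) (D : Fin n → Bool)
    {T B : Finset (Fin N)} (hBT : B ⊆ T) :
    (Finset.univ.filter (fun X : Fin n → Bool => StrayPattern LS L N T B X D)).card *
      2 ^ (L * B.card) ≤ (strayRange LS L D T).card.choose B.card * 2 ^ n := by
  set Q := strayRange LS L D T
  set A : Finset (B → ℕ) := (Fintype.piFinset (fun _ : B => Q)).filter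
    (fun q => ∀ i j : B, i < j → q i + L ≤ q j) with hA
  set F : (B → ℕ) → Finset (Fin n → Bool) := fun q => Finset.univ.filter
    (fun X : Fin n → Bool => ∀ i (hi : i ∈ B), ∀ w : Fin n,
      pivotStart LS L i ≤ w → (w : ℕ) < pivotStart LS L i + L →
        ∃ v, v ≠ w ∧ D v = false ∧ rank D v + pivotStart LS L i = q ⟨i, hi⟩ + w ∧ X v = X w)
    with hF
  have hAcard : A.card ≤ Q.card.choose B.card := by
    have := card_strictMono_le_choose Q A (fun q hq => by
      simp only [hA, Finset.mem_filter, Fintype.mem_piFinset] at hq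
      refine ⟨fun i j hij => ?_, hq.1⟩
      have := hq.2 i j hij
      have := hl.one_le
      omega)
    rwa [Fintype.card_coe] at this
  have hsub : (Finset.univ.filter (fun X : Fin n → Bool => StrayPattern LS L N T B X D)) ⊆
      A.biUnion F := by
    intro X hX
    simp only [Finset.mem_filter, Finset.mem_univ, true_and] at hX
    obtain ⟨hiso, hstray⟩ := hX
    have hB : ∀ i : B, StrayAt LS L N X D i := fun i => (hstray i (hBT i.2)).mpr i.2
    choose q hq1 hq2 hq3 using hB
    simp only [Finset.mem_biUnion]
    refine ⟨q, ?_, ?_⟩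
    · simp only [hA, Finset.mem_filter, Fintype.mem_piFinset]
      exact ⟨fun i => stray_mem_strayRange hl hiso (hBT i.2) (hq1 i),
        fun i j hij => ordered_answer hl hij (hq1 i) (hq1 j)⟩
    · simp only [hF, Finset.mem_filter, Finset.mem_univ, true_and]
      intro i hi w h1 h2
      have hfit := hl.fit i i.2
      have hcopy := copy_answer (hq1 ⟨i, hi⟩)
      obtain ⟨v, hv1, hv2, hv3⟩ := (isCopyAt_pivot_iff X D (by simp only; omega)).mp hcopy w h1 h2
      refine ⟨v, ?_, hv1, hv2, hv3⟩
      -- A bit of the copy that is its own pivot bit would make the match correct, since a stray has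
      -- at most one deletion.
      rintro rfl
      exact hq2 ⟨i, hi⟩
        (isCorrectMatch_of_aligned (by simp only; omega) hcopy (hq3 ⟨i, hi⟩) h1 h2 hv1 hv2)
  have hFcard : ∀ q ∈ A, (F q).card * 2 ^ (L * B.card) ≤ 2 ^ n := by
    intro q hq
    simp only [hA, Finset.mem_filter, Fintype.mem_piFinset] at hq
    have := card_inputs_with_copies_le hl D B (fun i => if hi : i ∈ B then q ⟨i, hi⟩ else 0) (by
      intro i hi j hj hij
      simp only [hi, hj, dif_pos]
      exact hq.2 ⟨i, hi⟩ ⟨j, hj⟩ hij)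
    refine le_trans (le_of_eq ?_) this
    congr 2
    ext X
    simp only [hF, Finset.mem_filter, Finset.mem_univ, true_and]
    refine forall_congr' fun i => ?_
    by_cases hi : i ∈ B <;> simp [hi]
  calc _ ≤ (A.biUnion F).card * 2 ^ (L * B.card) :=
        Nat.mul_le_mul_right _ (Finset.card_le_card hsub)
    _ ≤ (∑ q ∈ A, (F q).card) * 2 ^ (L * B.card) :=
        Nat.mul_le_mul_right _ Finset.card_biUnion_le
    _ = ∑ q ∈ A, (F q).card * 2 ^ (L * B.card) := Finset.sum_mul _ _ _
    _ ≤ ∑ _q ∈ A, 2 ^ n := Finset.sum_le_sum hFcard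
    _ = A.card * 2 ^ n := by simp
    _ ≤ _ := Nat.mul_le_mul_right _ hAcard

open Classical in
theorem channelProb_eq_sum_card (β : ℝ) (E : (Fin n → Bool) → (Fin n → Bool) → Prop) :
    channelProb n β E = ∑ D : Fin n → Bool, (∏ j, (if D j = true then β else 1 - β)) *
      ((1 / 2) ^ n * ((Finset.univ.filter (fun X => E X D)).card : ℝ)) := by
  unfold channelProb
  rw [Finset.sum_comm]
  refine Finset.sum_congr rfl fun D _ => ?_
  rw [Finset.card_filter, Nat.cast_sum, Finset.mul_sum, Finset.mul_sum]
  refine Finset.sum_congr rfl fun X _ => ?_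
  split_ifs <;> simp [mul_comm]

/-- The probability of a stray pattern. -/
theorem channelProb_strayPattern_le (hl : Layout n LS L N) {β : ℝ} (hβ0 : 0 < β) (hβ1 : β ≤ 1)
    (hrange : β * (3 * (LS + L) + 3) ≤ 4) (hLβ : (L + 2) * β ≤ 1)
    {T B : Finset (Fin N)} (hBT : B ⊆ T) :
    channelProb n β (StrayPattern LS L N T B) ≤
      ((L + 2) * β * Real.exp 5) ^ (T \ B).card *
        (Real.exp 5 * ((1 / 2) ^ L / β)) ^ B.card := by
  classical
  -- Base for Markov's inequality on the number of deletions in the windows of `T`. The expected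
  -- number is at most `T.card / y`, so the expectation of `y` to this number is at most `exp
  -- T.card`.
  set y : ℝ := ((L + 2) * β)⁻¹ with hy
  have hpos : 0 < (L + 2) * β := by positivity
  have hy1 : 1 ≤ y := (one_le_inv₀ hpos).mpr hLβ
  have hy0 : 0 < y := by positivity
  have hcard : (T \ B).card + B.card = T.card := Finset.card_sdiff_add_card_eq_card hBT
  set J := T.biUnion (fun t => window n LS L t) with hJ
  set K : ℝ := Real.exp (4 * T.card) * (((1 / 2) ^ L / β) ^ B.card) with hK
  have hpt : ∀ D : Fin n → Bool, (1 / 2 : ℝ) ^ n *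
      ((Finset.univ.filter (fun X => StrayPattern LS L N T B X D)).card : ℝ) ≤
      K * (y⁻¹) ^ (T \ B).card * y ^ (J.filter (fun j => D j = true)).card := by
    intro D
    -- By the exchange argument no input has the pattern unless the deletions pay for all of `T \
    -- B`. If they do, the powers of `y` multiply to at least one and may be inserted.
    by_cases hd : (T \ B).card ≤ (J.filter (fun j => D j = true)).card
    · have h1 : (1 / 2 : ℝ) ^ n *
          ((Finset.univ.filter (fun X => StrayPattern LS L N T B X D)).card : ℝ) ≤ K := by
        have hc : ((Finset.univ.filter (fun X => StrayPattern LS L N T B X D)).card : ℝ) *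
          2 ^ (L * B.card) ≤ ((strayRange LS L D T).card.choose B.card : ℝ) * 2 ^ n := by
          exact_mod_cast card_strayPattern_mul_le hl D hBT
        have hch := choose_mul_pow_le_exp hβ0.le (strayRange LS L D T).card B.card
        have hexp : Real.exp (β * (strayRange LS L D T).card) ≤ Real.exp (4 * T.card) := by
          rw [Real.exp_le_exp]
          have : ((strayRange LS L D T).card : ℝ) ≤ T.card * (3 * (LS + L) + 3) := by
            exact_mod_cast card_strayRange_le D T
          calc β * ((strayRange LS L D T).card : ℝ) ≤ β * (T.card * (3 * (LS + L) + 3)) := by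
                gcongr
            _ = (β * (3 * (LS + L) + 3)) * T.card := by ring
            _ ≤ 4 * T.card := by gcongr
        have e1 : ((1 / 2 : ℝ) ^ L / β) ^ B.card = ((2 : ℝ) ^ (L * B.card))⁻¹ * (β ^ B.card)⁻¹ := by
          rw [div_pow, ← pow_mul, one_div, inv_pow, div_eq_mul_inv]
        have e2 : (1 / 2 : ℝ) ^ n = (2 ^ n)⁻¹ := by rw [one_div, inv_pow]
        set c : ℝ := ((Finset.univ.filter (fun X => StrayPattern LS L N T B X D)).card : ℝ)
        rw [hK, e1, e2]
        have hβw : 0 < β ^ B.card := by positivity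
        have h2L : (0 : ℝ) < 2 ^ (L * B.card) := by positivity
        have h2n : (0 : ℝ) < 2 ^ n := by positivity
        calc (2 ^ n)⁻¹ * c = (2 ^ n)⁻¹ * (c * 2 ^ (L * B.card)) * (2 ^ (L * B.card))⁻¹ := by
              field_simp
          _ ≤ (2 ^ n)⁻¹ * (((strayRange LS L D T).card.choose B.card : ℝ) * 2 ^ n) *
                (2 ^ (L * B.card))⁻¹ := by gcongr
          _ = (((strayRange LS L D T).card.choose B.card : ℝ) * β ^ B.card) *
                ((2 ^ (L * B.card))⁻¹ * (β ^ B.card)⁻¹) := by field_simp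
          _ ≤ _ := by
              gcongr
              exact hch.trans hexp
      have h2 : 1 ≤ (y⁻¹) ^ (T \ B).card * y ^ (J.filter (fun j => D j = true)).card := by
        rw [inv_pow, ← div_eq_inv_mul, one_le_div (by positivity)]
        exact pow_le_pow_right₀ hy1 hd
      have hK0 : 0 ≤ K := by positivity
      rw [mul_assoc]
      exact h1.trans (le_mul_of_one_le_right hK0 h2)
    · have : (Finset.univ.filter (fun X => StrayPattern LS L N T B X D)) = ∅ := by
        rw [Finset.filter_eq_empty_iff]
        intro X _ hX
        have h1 := card_sub_strays_le_deletions hl hX.1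
        have h2 : T.filter (fun t => StrayAt LS L N X D t) = B := by
          ext t
          simp only [Finset.mem_filter]
          exact ⟨fun h => (hX.2 t h.1).mp h.2, fun h => ⟨hBT h, (hX.2 t (hBT h)).mpr h⟩⟩
        rw [h2] at h1
        have h3 : T.card ≤ B.card + (J.filter (fun j => D j = true)).card := by
          convert h1
        omega
      rw [this]
      simp only [Finset.card_empty, Nat.cast_zero, mul_zero]
      positivity
  have hJcard : (J.card : ℝ) ≤ T.card * (L + 2) := by
    have : J.card ≤ T.card * (L + 2) :=
      Finset.card_biUnion_le_card_mul _ _ _ fun t _ => card_window_le _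
    exact_mod_cast this
  have hmgf : (1 - β + β * y) ^ J.card ≤ Real.exp T.card := by
    have h1 : 1 - β + β * y ≤ Real.exp (β * y) := by
      have := Real.add_one_le_exp (β * y)
      linarith
    have h0 : 0 ≤ 1 - β + β * y := by
      have : 0 ≤ β * y := by positivity
      linarith
    calc (1 - β + β * y) ^ J.card ≤ Real.exp (β * y) ^ J.card := by gcongr
      _ = Real.exp (J.card * (β * y)) := (Real.exp_nat_mul _ _).symm
      _ ≤ Real.exp T.card := by
          rw [Real.exp_le_exp]
          calc (J.card : ℝ) * (β * y) ≤ T.card * (L + 2) * (β * y) := by gcongr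
            _ = T.card := by
                rw [hy]
                field_simp
  rw [channelProb_eq_sum_card]
  have hω : ∀ D : Fin n → Bool, (0 : ℝ) ≤ ∏ j, (if D j = true then β else 1 - β) :=
    fun D => Finset.prod_nonneg fun j _ => by split_ifs <;> linarith
  calc _ ≤ ∑ D : Fin n → Bool, (∏ j, (if D j = true then β else 1 - β)) *
        (K * (y⁻¹) ^ (T \ B).card * y ^ (J.filter (fun j => D j = true)).card) :=
        Finset.sum_le_sum fun D _ => mul_le_mul_of_nonneg_left (hpt D) (hω D)
    _ = K * (y⁻¹) ^ (T \ B).card * ∑ D : Fin n → Bool,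
          (∏ j, (if D j = true then β else 1 - β)) *
            y ^ (J.filter (fun j => D j = true)).card := by
        rw [Finset.mul_sum]
        exact Finset.sum_congr rfl fun D _ => by ring
    _ = K * (y⁻¹) ^ (T \ B).card * (1 - β + β * y) ^ J.card := by
        rw [sum_weight_mul_pow_card]
    _ ≤ K * (y⁻¹) ^ (T \ B).card * Real.exp T.card := by gcongr
    _ = _ := by
        have e1 : Real.exp (4 * T.card) * Real.exp T.card =
            Real.exp 5 ^ (T \ B).card * Real.exp 5 ^ B.card := by
          rw [← pow_add, hcard, ← Real.exp_add, ← Real.exp_nat_mul]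
          congr 1
          ring
        rw [hK, hy, inv_inv, mul_pow _ (Real.exp 5), mul_pow (Real.exp 5)]
        linear_combination ((((1 / 2 : ℝ) ^ L / β) ^ B.card) * ((L + 2) * β) ^ (T \ B).card) * e1

end Stray

/-! ### Summation over clusters around the strays. -/

section Clusters

variable {N : ℕ}

theorem sum_Ici_pow_le {s : ℝ} (h0 : 0 ≤ s) (h1 : s < 1) (i : Fin N) :
    ∑ v ∈ Finset.Ici i, s ^ ((v : ℕ) - i) ≤ (1 - s)⁻¹ := by
  rw [← Finset.sum_image (f := fun k => s ^ k) (g := fun v : Fin N => (v : ℕ) - i)]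
  · rw [← tsum_geometric_of_lt_one h0 h1]
    exact (summable_geometric_of_lt_one h0 h1).sum_le_tsum _ fun _ _ => by positivity
  · intro v hv w hw h
    simp only [Finset.coe_Ici, Set.mem_Ici, Fin.le_def] at hv hw h
    exact Fin.ext (by omega)

theorem sum_Iic_pow_le {s : ℝ} (h0 : 0 ≤ s) (h1 : s < 1) (i : Fin N) :
    ∑ u ∈ Finset.Iic i, s ^ ((i : ℕ) - u) ≤ (1 - s)⁻¹ := by
  rw [← Finset.sum_image (f := fun k => s ^ k) (g := fun u : Fin N => (i : ℕ) - u)]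
  · rw [← tsum_geometric_of_lt_one h0 h1]
    exact (summable_geometric_of_lt_one h0 h1).sum_le_tsum _ fun _ _ => by positivity
  · intro v hv w hw h
    simp only [Finset.coe_Iic, Set.mem_Iic, Fin.le_def] at hv hw h
    exact Fin.ext (by omega)

theorem sum_interval_pow_le {s : ℝ} (h0 : 0 ≤ s) (h1 : s < 1) (i : Fin N) :
    ∑ p ∈ Finset.Iic i ×ˢ Finset.Ici i, s ^ (((i : ℕ) - p.1) + ((p.2 : ℕ) - i)) ≤
      ((1 - s)⁻¹) ^ 2 := by
  rw [Finset.sum_product]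
  simp_rw [pow_add]
  rw [← Finset.sum_mul_sum, sq]
  have : 0 ≤ (1 - s)⁻¹ := inv_nonneg.mpr (by linarith)
  exact mul_le_mul (sum_Iic_pow_le h0 h1 i) (sum_Ici_pow_le h0 h1 i)
    (Finset.sum_nonneg fun _ _ => by positivity) this

/-- Every point of `T` is joined within `T` to a point of `B`. -/
def Clustered (T B : Finset (Fin N)) : Prop :=
  B ⊆ T ∧ ∀ t ∈ T, ∃ b ∈ B, ∀ c ∈ Set.uIcc b t, c ∈ T

theorem exists_right_end (T B : Finset (Fin N)) (b : Fin N) :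
    ∃ e, b ≤ e ∧ (∀ c, b < c → c ≤ e → c ∈ T \ B) ∧
      ∀ t, b ≤ t → (∀ c, b < c → c ≤ t → c ∈ T \ B) → t ≤ e := by
  classical
  set S := Finset.univ.filter (fun e => b ≤ e ∧ ∀ c, b < c → c ≤ e → c ∈ T \ B) with hS
  have hb : b ∈ S := by
    simp only [hS, Finset.mem_filter, Finset.mem_univ, true_and]
    exact ⟨le_rfl, fun c h1 h2 => absurd h1 (not_lt.mpr h2)⟩
  have hm := Finset.max'_mem S ⟨b, hb⟩
  simp only [hS, Finset.mem_filter, Finset.mem_univ, true_and] at hm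
  exact ⟨_, hm.1, hm.2, fun t h1 h2 => Finset.le_max' S t (by
    simp only [hS, Finset.mem_filter, Finset.mem_univ, true_and]
    exact ⟨h1, h2⟩)⟩

theorem exists_left_end (T B : Finset (Fin N)) (b : Fin N) :
    ∃ e, e ≤ b ∧ (∀ c, c < b → e ≤ c → c ∈ T \ B) ∧
      ∀ t, t ≤ b → (∀ c, c < b → t ≤ c → c ∈ T \ B) → e ≤ t := by
  classical
  set S := Finset.univ.filter (fun e => e ≤ b ∧ ∀ c, c < b → e ≤ c → c ∈ T \ B) with hS
  have hb : b ∈ S := by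
    simp only [hS, Finset.mem_filter, Finset.mem_univ, true_and]
    exact ⟨le_rfl, fun c h1 h2 => absurd h1 (not_lt.mpr h2)⟩
  have hm := Finset.min'_mem S ⟨b, hb⟩
  simp only [hS, Finset.mem_filter, Finset.mem_univ, true_and] at hm
  exact ⟨_, hm.1, hm.2, fun t h1 h2 => Finset.min'_le S t (by
    simp only [hS, Finset.mem_filter, Finset.mem_univ, true_and]
    exact ⟨h1, h2⟩)⟩

/-- Walking from `t` towards the point of `B` to which it is joined, the first point of `B` that is
met has `t` in one of its two runs. -/
theorem Clustered.eq_biUnion {T B : Finset (Fin N)} (h : Clustered T B) {l e : Fin N → Fin N}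
    (hl : ∀ b, l b ≤ b ∧ (∀ c, c < b → l b ≤ c → c ∈ T \ B) ∧
      ∀ t, t ≤ b → (∀ c, c < b → t ≤ c → c ∈ T \ B) → l b ≤ t)
    (he : ∀ b, b ≤ e b ∧ (∀ c, b < c → c ≤ e b → c ∈ T \ B) ∧
      ∀ t, b ≤ t → (∀ c, b < c → c ≤ t → c ∈ T \ B) → t ≤ e b) :
    T = B.biUnion (fun b => Finset.Icc (l b) (e b)) := by
  ext t
  simp only [Finset.mem_biUnion, Finset.mem_Icc]
  constructor
  · intro ht
    obtain ⟨b, hb, hbt⟩ := h.2 t ht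
    rcases le_total b t with hle | hle
    · rw [Set.uIcc_of_le hle] at hbt
      set S := B.filter (fun c => c ≤ t) with hS
      have hbS : b ∈ S := by simp [hS, hb, hle]
      have hm := Finset.max'_mem S ⟨b, hbS⟩
      have hmax : ∀ c ∈ S, c ≤ S.max' ⟨b, hbS⟩ := fun c hc => Finset.le_max' _ _ hc
      set b' := S.max' ⟨b, hbS⟩
      simp only [hS, Finset.mem_filter] at hm
      refine ⟨b', hm.1, (hl b').1.trans hm.2, (he b').2.2 t hm.2 fun c h1 h2 => ?_⟩
      rw [Finset.mem_sdiff]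
      refine ⟨hbt c ⟨(hmax b hbS).trans h1.le, h2⟩, fun hcB => ?_⟩
      exact absurd h1 (not_lt.mpr (hmax c (by simp [hS, hcB, h2])))
    · rw [Set.uIcc_of_ge hle] at hbt
      set S := B.filter (fun c => t ≤ c) with hS
      have hbS : b ∈ S := by simp [hS, hb, hle]
      have hm := Finset.min'_mem S ⟨b, hbS⟩
      have hmin : ∀ c ∈ S, S.min' ⟨b, hbS⟩ ≤ c := fun c hc => Finset.min'_le _ _ hc
      set b' := S.min' ⟨b, hbS⟩
      simp only [hS, Finset.mem_filter] at hm
      refine ⟨b', hm.1, (hl b').2.2 t hm.2 fun c h1 h2 => ?_, hm.2.trans (he b').1⟩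
      rw [Finset.mem_sdiff]
      refine ⟨hbt c ⟨h2, h1.le.trans (hmin b hbS)⟩, fun hcB => ?_⟩
      exact absurd h1 (not_lt.mpr (hmin c (by simp [hS, hcB, h2])))
  · rintro ⟨b, hb, h1, h2⟩
    rcases lt_trichotomy t b with hlt | rfl | hlt
    · exact (Finset.mem_sdiff.mp ((hl b).2.1 t hlt h1)).1
    · exact h.1 hb
    · exact (Finset.mem_sdiff.mp ((he b).2.1 t hlt h2)).1

/-- The right runs of different points of `B` are disjoint: a common point would force one run to
pass through the starting point of the other, which lies in `B`. -/
theorem sum_right_le_card {T B : Finset (Fin N)} {e : Fin N → Fin N}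
    (he : ∀ b, b ≤ e b ∧ ∀ c, b < c → c ≤ e b → c ∈ T \ B) :
    ∑ b ∈ B, ((e b : ℕ) - b) ≤ (T \ B).card := by
  have h1 : ∀ b : Fin N, (e b : ℕ) - b = (Finset.Ioc b (e b)).card := fun b => by simp
  simp_rw [h1]
  rw [← Finset.card_biUnion]
  · refine Finset.card_le_card fun c hc => ?_
    simp only [Finset.mem_biUnion, Finset.mem_Ioc] at hc
    obtain ⟨b, -, h2, h3⟩ := hc
    exact (he b).2 c h2 h3
  · intro b hb b' hb' hne
    rw [Function.onFun, Finset.disjoint_left]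
    intro c hc hc'
    simp only [Finset.mem_Ioc] at hc hc'
    rcases lt_or_gt_of_ne hne with h | h
    · exact (Finset.mem_sdiff.mp ((he b).2 b' h (hc'.1.le.trans hc.2))).2 hb'
    · exact (Finset.mem_sdiff.mp ((he b').2 b h (hc.1.le.trans hc'.2))).2 hb

theorem sum_left_le_card {T B : Finset (Fin N)} {l : Fin N → Fin N}
    (hl : ∀ b, l b ≤ b ∧ ∀ c, c < b → l b ≤ c → c ∈ T \ B) :
    ∑ b ∈ B, ((b : ℕ) - l b) ≤ (T \ B).card := by
  have h1 : ∀ b : Fin N, (b : ℕ) - l b = (Finset.Ico (l b) b).card := fun b => by simp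
  simp_rw [h1]
  rw [← Finset.card_biUnion]
  · refine Finset.card_le_card fun c hc => ?_
    simp only [Finset.mem_biUnion, Finset.mem_Ico] at hc
    obtain ⟨b, -, h2, h3⟩ := hc
    exact (hl b).2 c h3 h2
  · intro b hb b' hb' hne
    rw [Function.onFun, Finset.disjoint_left]
    intro c hc hc'
    simp only [Finset.mem_Ico] at hc hc'
    rcases lt_or_gt_of_ne hne with h | h
    · exact (Finset.mem_sdiff.mp ((hl b').2 b h (hc'.1.trans hc.2.le))).2 hb
    · exact (Finset.mem_sdiff.mp ((hl b).2 b' h (hc.1.trans hc'.2.le))).2 hb'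

-- A clustered set is recovered from its maximal runs to the left and right of the points of `B`, so
-- the sum is dominated by independent choices of two run lengths per point. A point of `T \ B` may
-- lie both in a right run and in a left run; this is why its weight is `s ^ 2`.
open Classical in
theorem sum_clustered_pow_le {s : ℝ} (h0 : 0 ≤ s) (h1 : s < 1) (B : Finset (Fin N)) :
    ∑ T ∈ Finset.univ.filter (fun T => Clustered T B), (s ^ 2) ^ (T \ B).card ≤
      (((1 - s)⁻¹) ^ 2) ^ B.card := by
  choose e he using fun T => exists_right_end T B
  choose l hl using fun T => exists_left_end T B
  set f : Finset (Fin N) → B → Fin N × Fin N := fun T b => (l T b, e T b) with hf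
  set w : (B → Fin N × Fin N) → ℝ := fun p =>
    ∏ b : B, s ^ (((b : ℕ) - (p b).1) + (((p b).2 : ℕ) - b)) with hw
  have hterm : ∀ T, (s ^ 2) ^ (T \ B).card ≤ w (f T) := by
    intro T
    rw [hw, ← pow_mul]
    simp only [hf]
    rw [Finset.prod_pow_eq_pow_sum, Finset.sum_coe_sort B
      (fun b => ((b : ℕ) - l T b) + ((e T b : ℕ) - b)), Finset.sum_add_distrib]
    refine pow_le_pow_of_le_one h0 h1.le ?_
    have a1 := sum_right_le_card (T := T) (B := B) fun b => ⟨(he T b).1, (he T b).2.1⟩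
    have a2 := sum_left_le_card (T := T) (B := B) fun b => ⟨(hl T b).1, (hl T b).2.1⟩
    omega
  refine (Finset.sum_le_sum fun T _ => hterm T).trans ?_
  rw [← Finset.sum_image (f := w) (g := f)]
  · refine (Finset.sum_le_sum_of_subset_of_nonneg
      (t := Fintype.piFinset fun b : B => Finset.Iic b.1 ×ˢ Finset.Ici b.1) ?_ ?_).trans ?_
    · intro p hp
      obtain ⟨T, -, rfl⟩ := Finset.mem_image.mp hp
      simp only [Fintype.mem_piFinset, Finset.mem_product, Finset.mem_Iic, Finset.mem_Ici, hf]
      exact fun b => ⟨(hl T b).1, (he T b).1⟩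
    · exact fun p _ _ => Finset.prod_nonneg fun b _ => by positivity
    · rw [← Finset.prod_univ_sum (fun b : B => Finset.Iic b.1 ×ˢ Finset.Ici b.1)
        (fun b p => s ^ (((b : ℕ) - p.1) + ((p.2 : ℕ) - b)))]
      calc _ ≤ ∏ _b : B, ((1 - s)⁻¹) ^ 2 :=
            Finset.prod_le_prod (fun b _ => Finset.sum_nonneg fun _ _ => by positivity)
              (fun b _ => sum_interval_pow_le h0 h1 b.1)
        _ = _ := by simp
  · intro T hT T' hT' h
    simp only [Finset.coe_filter, Finset.mem_univ, true_and, Set.mem_ofPred_eq] at hT hT'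
    rw [hT.eq_biUnion (hl T) (he T), hT'.eq_biUnion (hl T') (he T')]
    refine Finset.biUnion_congr rfl fun b hb => ?_
    have := congrFun h ⟨b, hb⟩
    simp only [hf, Prod.mk.injEq] at this
    rw [this.1, this.2]

open Classical in
theorem sum_sum_clustered_le {s b : ℝ} (h0 : 0 ≤ s) (h1 : s < 1) (hb : 0 ≤ b) :
    ∑ B : Finset (Fin N), ∑ T ∈ Finset.univ.filter (fun T => Clustered T B),
      (s ^ 2) ^ (T \ B).card * b ^ B.card ≤ Real.exp (N * (b * ((1 - s)⁻¹) ^ 2)) := by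
  calc _ ≤ ∑ B : Finset (Fin N), (b * ((1 - s)⁻¹) ^ 2) ^ B.card := by
        refine Finset.sum_le_sum fun B _ => ?_
        rw [← Finset.sum_mul, mul_comm, mul_pow]
        gcongr
        exact sum_clustered_pow_le h0 h1 B
    _ = (b * ((1 - s)⁻¹) ^ 2 + 1) ^ N := by
        have := Finset.sum_pow_mul_eq_add_pow (b * ((1 - s)⁻¹) ^ 2) 1
          (Finset.univ : Finset (Fin N))
        simpa using this
    _ ≤ Real.exp (b * ((1 - s)⁻¹) ^ 2) ^ N := by
        gcongr
        exact Real.add_one_le_exp _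
    _ = _ := (Real.exp_nat_mul _ _).symm

-- Taking `i` out of `B` leaves the binomial expansion over the subsets of `T.erase i`.
open Classical in
theorem sum_subsets_containing {a b : ℝ} {T : Finset (Fin N)} {i : Fin N} (hi : i ∈ T) :
    ∑ B ∈ T.powerset.filter (fun B => i ∈ B), a ^ (T \ B).card * b ^ B.card =
      b * (b + a) ^ (T.card - 1) := by
  rw [← Finset.card_erase_of_mem hi, ← Finset.sum_pow_mul_eq_add_pow, Finset.mul_sum]
  symm
  refine Finset.sum_bij' (fun S _ => insert i S) (fun B _ => B.erase i) ?_ ?_ ?_ ?_ ?_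
  · intro S hS
    rw [Finset.mem_powerset] at hS
    simp only [Finset.mem_filter, Finset.mem_powerset, Finset.mem_insert_self, and_true]
    exact Finset.insert_subset hi (hS.trans (Finset.erase_subset _ _))
  · intro B hB
    simp only [Finset.mem_filter, Finset.mem_powerset] at hB ⊢
    exact Finset.erase_subset_erase _ hB.1
  · intro S hS
    rw [Finset.mem_powerset] at hS
    exact Finset.erase_insert fun h => Finset.notMem_erase i T (hS h)
  · intro B hB
    simp only [Finset.mem_filter] at hB
    exact Finset.insert_erase hB.2
  · intro S hS
    rw [Finset.mem_powerset] at hS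
    have hiS : i ∉ S := fun h => Finset.notMem_erase i T (hS h)
    rw [Finset.card_insert_of_notMem hiS, ← Finset.card_sdiff_of_subset hS]
    have : T.erase i \ S = T \ insert i S := by
      ext x
      simp only [Finset.mem_sdiff, Finset.mem_erase, Finset.mem_insert]
      tauto
    rw [this]
    ring

end Clusters

/-! ### Bounds for the number of strays and for a single stray. -/

section StrayProb

variable {n LS L N : ℕ}

theorem not_correctAt_of_strayAt {X D : Fin n → Bool} {i : Fin N}
    (h : StrayAt LS L N X D i) : ¬ CorrectAt LS L N X D i := by
  rintro ⟨q, hq, hc⟩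
  obtain ⟨r, hr, hn, -⟩ := h
  have : q = r := by
    have := hq.symm.trans hr
    simpa using this
  exact hn (this ▸ hc)

open Classical in
/-- The pivots that no correctly matched pivot separates from `B`. -/
theorem isolated_reachable {X D : Fin n → Bool} (B : Finset (Fin N)) :
    Isolated LS L N X D (Finset.univ.filter (fun t => ∃ b ∈ B, ∀ c ∈ Set.uIcc b t,
      ¬ CorrectAt LS L N X D c)) := by
  constructor
  · intro t ht
    simp only [Finset.mem_filter, Finset.mem_univ, true_and] at ht
    obtain ⟨b, -, hb⟩ := ht
    exact hb t Set.right_mem_uIcc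
  · intro t ht i hi
    simp only [Finset.mem_filter, Finset.mem_univ, true_and] at ht hi
    obtain ⟨b, hbB, hb⟩ := ht
    push Not at hi
    obtain ⟨c, hc, hcor⟩ := hi b hbB
    rcases Set.uIcc_subset_uIcc_union_uIcc (b := t) hc with h | h
    · exact absurd hcor (hb c h)
    · exact ⟨c, h, hcor⟩

open Classical in
/-- The number of strays is small with overwhelming probability. -/
theorem channelProb_card_stray_ge_le (hl : Layout n LS L N) {β : ℝ} (hβ0 : 0 < β) (hβ1 : β ≤ 1)
    (hrange : β * (3 * (LS + L) + 3) ≤ 4) (hLβ : (L + 2) * β ≤ 1) {s b : ℝ} (h0 : 0 ≤ s)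
    (h1 : s < 1) (hs : (L + 2) * β * Real.exp 5 ≤ s ^ 2)
    (hb : Real.exp 5 * ((1 / 2) ^ L / β) ≤ b) (x : ℝ) :
    channelProb n β (fun X D =>
        x ≤ ((Finset.univ.filter (fun i : Fin N => StrayAt LS L N X D i)).card : ℝ)) ≤
      Real.exp (N * (Real.exp 1 * b * ((1 - s)⁻¹) ^ 2) - x) := by
  have hb0 : 0 ≤ b := le_trans (by positivity) hb
  set I := (Finset.univ : Finset (Finset (Fin N))).sigma
    (fun B => Finset.univ.filter (fun T => Clustered T B)) with hI
  have hunion := channelProb_le_sum (n := n) hβ0.le hβ1 (I.filter (fun p => x ≤ (p.1.card : ℝ)))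
    (E := fun X D =>
        x ≤ ((Finset.univ.filter (fun i : Fin N => StrayAt LS L N X D i)).card : ℝ))
    (F := fun p => StrayPattern LS L N p.2 p.1) (fun X D hx => by
      -- The pattern of an outcome consists of all strays and of all pivots reachable from them
      -- without meeting a correctly matched pivot.
      set B := Finset.univ.filter (fun i : Fin N => StrayAt LS L N X D i) with hB
      set T := Finset.univ.filter (fun t => ∃ b ∈ B, ∀ c ∈ Set.uIcc b t,
        ¬ CorrectAt LS L N X D c) with hT
      refine ⟨⟨B, T⟩, ?_, isolated_reachable B, fun t _ => by simp [hB]⟩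
      simp only [hI, Finset.mem_filter, Finset.mem_sigma, Finset.mem_univ, true_and]
      refine ⟨⟨?_, ?_⟩, hx⟩
      · intro t ht
        simp only [hT, Finset.mem_filter, Finset.mem_univ, true_and]
        refine ⟨t, ht, fun c hc => ?_⟩
        rw [Set.uIcc_self, Set.mem_singleton_iff] at hc
        subst hc
        simp only [hB, Finset.mem_filter, Finset.mem_univ, true_and] at ht
        exact not_correctAt_of_strayAt ht
      · intro t ht
        simp only [hT, Finset.mem_filter, Finset.mem_univ, true_and] at ht ⊢
        obtain ⟨b, hbB, hb⟩ := ht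
        refine ⟨b, hbB, fun c hc => ⟨b, hbB, fun d hd => hb d ?_⟩⟩
        exact Set.uIcc_subset_uIcc Set.left_mem_uIcc hc hd)
  refine hunion.trans ?_
  have hterm : ∀ p ∈ I.filter (fun p => x ≤ (p.1.card : ℝ)),
      channelProb n β (StrayPattern LS L N p.2 p.1) ≤
        Real.exp (-x) * ((s ^ 2) ^ (p.2 \ p.1).card * (Real.exp 1 * b) ^ p.1.card) := by
    intro p hp
    simp only [hI, Finset.mem_filter, Finset.mem_sigma, Finset.mem_univ, true_and] at hp
    -- Exponential Markov inequality: there are at least `x` strays, so this factor may be inserted;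
    -- it turns `b` into `Real.exp 1 * b`.
    have hx : 1 ≤ Real.exp (-x) * Real.exp 1 ^ p.1.card := by
      rw [← Real.exp_nat_mul, ← Real.exp_add, Real.one_le_exp_iff]
      linarith [hp.2]
    calc _ ≤ _ := channelProb_strayPattern_le hl hβ0 hβ1 hrange hLβ hp.1.1
      _ ≤ (s ^ 2) ^ (p.2 \ p.1).card * b ^ p.1.card := by gcongr
      _ ≤ ((s ^ 2) ^ (p.2 \ p.1).card * b ^ p.1.card) *
            (Real.exp (-x) * Real.exp 1 ^ p.1.card) := le_mul_of_one_le_right (by positivity) hx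
      _ = _ := by
          rw [mul_pow]
          ring
  calc _ ≤ ∑ p ∈ I.filter (fun p => x ≤ (p.1.card : ℝ)),
        Real.exp (-x) * ((s ^ 2) ^ (p.2 \ p.1).card * (Real.exp 1 * b) ^ p.1.card) :=
        Finset.sum_le_sum hterm
    _ ≤ ∑ p ∈ I, Real.exp (-x) * ((s ^ 2) ^ (p.2 \ p.1).card * (Real.exp 1 * b) ^ p.1.card) :=
        Finset.sum_le_sum_of_subset_of_nonneg (Finset.filter_subset _ _)
          (fun _ _ _ => by positivity)
    _ = Real.exp (-x) * ∑ B : Finset (Fin N), ∑ T ∈ Finset.univ.filter (fun T => Clustered T B),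
          (s ^ 2) ^ (T \ B).card * (Real.exp 1 * b) ^ B.card := by
        rw [← Finset.mul_sum, hI, Finset.sum_sigma]
    _ ≤ Real.exp (-x) * Real.exp (N * (Real.exp 1 * b * ((1 - s)⁻¹) ^ 2)) := by
        gcongr
        exact sum_sum_clustered_le h0 h1 (by positivity)
    _ = _ := by
        rw [← Real.exp_add]
        congr 1
        ring

/-- Each single pivot is a stray with small probability. -/
theorem channelProb_strayAt_le (hl : Layout n LS L N) {β : ℝ} (hβ0 : 0 < β) (hβ1 : β ≤ 1)
    (hrange : β * (3 * (LS + L) + 3) ≤ 4) (hLβ : (L + 2) * β ≤ 1) {a b : ℝ}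
    (ha : (L + 2) * β * Real.exp 5 ≤ a) (hb : Real.exp 5 * ((1 / 2) ^ L / β) ≤ b)
    (hab : b + a < 1) (i : Fin N) :
    channelProb n β (fun X D => StrayAt LS L N X D i) ≤ b * ((1 - (b + a))⁻¹) ^ 2 := by
  classical
  have hb0 : 0 ≤ b := le_trans (by positivity) hb
  have ha0 : 0 ≤ a := le_trans (by positivity) ha
  set I := (Finset.Iic i ×ˢ Finset.Ici i).sigma
    (fun p => (Finset.Icc p.1 p.2).powerset.filter (fun B => i ∈ B)) with hI
  have hunion := channelProb_le_sum (n := n) hβ0.le hβ1 I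
    (E := fun X D => StrayAt LS L N X D i)
    (F := fun p => StrayPattern LS L N (Finset.Icc p.1.1 p.1.2) p.2) (fun X D hx => by
      -- The pivots reachable from the single stray `i` form an interval, so the union bound runs
      -- over its two ends and over the sets of strays in it that contain `i`.
      set T := Finset.univ.filter (fun t => ∃ b ∈ ({i} : Finset (Fin N)), ∀ c ∈ Set.uIcc b t,
        ¬ CorrectAt LS L N X D c) with hT
      have hmemT : ∀ t, t ∈ T ↔ ∀ c ∈ Set.uIcc i t, ¬ CorrectAt LS L N X D c := by
        intro t
        simp [hT]
      have hiso : Isolated LS L N X D T := isolated_reachable {i}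
      have hiT : i ∈ T := by
        rw [hmemT]
        intro c hc
        rw [Set.uIcc_self, Set.mem_singleton_iff] at hc
        subst hc
        exact not_correctAt_of_strayAt hx
      have hclosed : ∀ t ∈ T, ∀ c ∈ Set.uIcc i t, c ∈ T := by
        intro t ht c hc
        rw [hmemT] at ht ⊢
        exact fun d hd => ht d (Set.uIcc_subset_uIcc Set.left_mem_uIcc hc hd)
      have hmin := Finset.min'_le T i hiT
      have hmax := Finset.le_max' T i hiT
      have hicc : Finset.Icc (T.min' ⟨i, hiT⟩) (T.max' ⟨i, hiT⟩) = T := by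
        ext t
        rw [Finset.mem_Icc]
        constructor
        · rintro ⟨h1, h2⟩
          rcases le_total t i with h | h
          · refine hclosed _ (Finset.min'_mem T ⟨i, hiT⟩) t ?_
            rw [Set.uIcc_of_ge hmin]
            exact ⟨h1, h⟩
          · refine hclosed _ (Finset.max'_mem T ⟨i, hiT⟩) t ?_
            rw [Set.uIcc_of_le hmax]
            exact ⟨h, h2⟩
        · exact fun ht => ⟨Finset.min'_le T t ht, Finset.le_max' T t ht⟩
      refine ⟨⟨(T.min' ⟨i, hiT⟩, T.max' ⟨i, hiT⟩), T.filter (fun t => StrayAt LS L N X D t)⟩,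
        ?_, ?_⟩
      · simp only [hI, Finset.mem_sigma, Finset.mem_product, Finset.mem_Iic, Finset.mem_Ici,
          Finset.mem_filter, Finset.mem_powerset]
        rw [hicc]
        exact ⟨⟨hmin, hmax⟩, Finset.filter_subset _ _, hiT, hx⟩
      · simp only [hicc]
        exact ⟨hiso, fun t ht => by simp [ht]⟩)
  refine hunion.trans ?_
  calc _ ≤ ∑ p ∈ I, a ^ (Finset.Icc p.1.1 p.1.2 \ p.2).card * b ^ p.2.card := by
        refine Finset.sum_le_sum fun p hp => ?_
        simp only [hI, Finset.mem_sigma, Finset.mem_filter, Finset.mem_powerset] at hp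
        refine (channelProb_strayPattern_le hl hβ0 hβ1 hrange hLβ hp.2.1).trans ?_
        gcongr
    _ = ∑ p ∈ Finset.Iic i ×ˢ Finset.Ici i,
          b * (b + a) ^ (((i : ℕ) - p.1) + ((p.2 : ℕ) - i)) := by
        rw [hI, Finset.sum_sigma]
        refine Finset.sum_congr rfl fun p hp => ?_
        simp only [Finset.mem_product, Finset.mem_Iic, Finset.mem_Ici] at hp
        rw [sum_subsets_containing (Finset.mem_Icc.mpr hp), Fin.card_Icc]
        have h1 : (p.1 : ℕ) ≤ i := hp.1
        have h2 : (i : ℕ) ≤ p.2 := hp.2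
        congr 2
        omega
    _ ≤ _ := by
        rw [← Finset.mul_sum]
        exact mul_le_mul_of_nonneg_left (sum_interval_pow_le (by positivity) hab i) hb0

end StrayProb

theorem dels_self_succ {n : ℕ} {D : Fin n → Bool} {v : Fin n} (hv : D v = true) :
    dels D v (v + 1) = 1 := by
  unfold dels
  rw [Finset.card_eq_one]
  refine ⟨v, ?_⟩
  ext l
  simp only [Finset.mem_filter, Finset.mem_univ, true_and, Finset.mem_singleton]
  constructor
  · rintro ⟨h1, h2, -⟩
    exact Fin.ext (by omega)
  · rintro rfl
    exact ⟨le_rfl, by omega, hv⟩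

/-! ### Probabilities of cylinder events. -/

section Cylinder

variable {n : ℕ}

/-- The bits in `K₁` are deleted, those in `K₀` are not, and those in `U` have the value `x`. -/
def Cylinder (K₁ K₀ U : Finset (Fin n)) (x : Bool) (ω : Fin n → Bool × Bool) : Prop :=
  (∀ v ∈ K₁, (ω v).2 = true) ∧ (∀ v ∈ K₀, (ω v).2 = false) ∧ ∀ v ∈ U, (ω v).1 = x

theorem dependsOn_cylinder {K₁ K₀ U W : Finset (Fin n)} {x : Bool} (h1 : K₁ ⊆ W) (h0 : K₀ ⊆ W)
    (hU : U ⊆ W) : DependsOn (Cylinder K₁ K₀ U x) (W : Set (Fin n)) := by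
  intro ω ω' h
  simp only [Cylinder]
  refine propext (and_congr ?_ (and_congr ?_ ?_))
  · exact forall₂_congr fun v hv => by rw [h v (h1 hv)]
  · exact forall₂_congr fun v hv => by rw [h v (h0 hv)]
  · exact forall₂_congr fun v hv => by rw [h v (hU hv)]

open Classical in
theorem prodExp_cylinder (β : ℝ) {K₁ K₀ U : Finset (Fin n)} (hK : Disjoint K₁ K₀) (x : Bool) :
    prodExp (bitWeight β) (fun ω => if Cylinder K₁ K₀ U x ω then (1 : ℝ) else 0) =
      β ^ K₁.card * (1 - β) ^ K₀.card * (1 / 2) ^ U.card := by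
  have h := prodExp_prod (ι := Fin n) (bitWeight β) (fun v a =>
    (if v ∈ K₁ then (if a.2 = true then (1 : ℝ) else 0) else 1) *
      (if v ∈ K₀ then (if a.2 = false then 1 else 0) else 1) *
      (if v ∈ U then (if a.1 = x then 1 else 0) else 1))
  have e1 : (fun ω : Fin n → Bool × Bool => if Cylinder K₁ K₀ U x ω then (1 : ℝ) else 0) =
      fun ω => ∏ v, (if v ∈ K₁ then (if (ω v).2 = true then (1 : ℝ) else 0) else 1) *
      (if v ∈ K₀ then (if (ω v).2 = false then 1 else 0) else 1) *
      (if v ∈ U then (if (ω v).1 = x then 1 else 0) else 1) := by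
    funext ω
    rw [Finset.prod_mul_distrib, Finset.prod_mul_distrib]
    simp only [Finset.prod_ite_mem, Finset.univ_inter, Finset.prod_ite_zero, Finset.prod_const_one]
    by_cases hC : Cylinder K₁ K₀ U x ω
    · rw [if_pos hC, if_pos hC.1, if_pos hC.2.1, if_pos hC.2.2]
      norm_num
    · rw [if_neg hC]
      split_ifs with a b c
      · exact absurd ⟨a, b, c⟩ hC
      all_goals norm_num
  rw [e1, h]
  have e2 : ∀ v : Fin n, ∑ a, bitWeight β a *
      ((if v ∈ K₁ then (if a.2 = true then (1 : ℝ) else 0) else 1) *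
      (if v ∈ K₀ then (if a.2 = false then 1 else 0) else 1) *
      (if v ∈ U then (if a.1 = x then 1 else 0) else 1)) =
      (if v ∈ K₁ then β else 1) * (if v ∈ K₀ then (1 - β) else 1) *
        (if v ∈ U then 1 / 2 else 1) := by
    intro v
    clear h e1
    simp only [Fintype.sum_prod_type, Fintype.sum_bool, bitWeight]
    by_cases h1 : v ∈ K₁
    · have h2 : v ∉ K₀ := fun h => Finset.disjoint_left.mp hK h1 h
      by_cases h3 : v ∈ U <;> cases x <;> simp [h1, h2, h3] <;> ring
    · by_cases h2 : v ∈ K₀ <;> by_cases h3 : v ∈ U <;> cases x <;> simp [h1, h2, h3] <;> ring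
  simp only [e2]
  rw [Finset.prod_mul_distrib, Finset.prod_mul_distrib]
  simp only [Finset.prod_ite_mem, Finset.univ_inter, Finset.prod_const]

end Cylinder

/-! ### Local copies, and pivots with two deletions. -/

section Nice

variable {n LS L N : ℕ}

/-- Pivot `i` has a copy within the image of its window. -/
def HasLocalCopy (LS L : ℕ) (X D : Fin n → Bool) (i : ℕ) : Prop :=
  ∃ q, IsCopyAt (pivot LS L X i) (channelOutput X D) q ∧
    rank D (pivotStart LS L i - 1) ≤ q ∧ q + L ≤ rank D (pivotStart LS L i + L + 1)

open Classical in
theorem card_hasLocalCopy_le (hl : Layout n LS L N) (X D : Fin n → Bool) :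
    (Finset.univ.filter (fun i : Fin N => HasLocalCopy LS L X D i)).card ≤
      (matchedSet (answer LS L N X D)).card := by
  set m : Fin N → Option ℕ := fun i => if h : HasLocalCopy LS L X D i then some h.choose else none
    with hm
  have hsome : ∀ i q, m i = some q → IsCopyAt (pivot LS L X i) (channelOutput X D) q ∧
      rank D (pivotStart LS L i - 1) ≤ q ∧ q + L ≤ rank D (pivotStart LS L i + L + 1) := by
    intro i q hq
    by_cases h : HasLocalCopy LS L X D i
    · simp only [hm, h, dif_pos, Option.some.injEq] at hq
      rw [← hq]
      exact h.choose_spec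
    · simp [hm, h] at hq
  have := card_le_card_maxMatching (isMatching_of_window hl m (fun i q h => (hsome i q h).1)
    (fun i q h => (hsome i q h).2.1) (fun i q h => (hsome i q h).2.2))
  refine le_trans (Finset.card_le_card fun i hi => ?_) this
  rw [Finset.mem_filter] at hi
  rw [mem_matchedSet]
  exact ⟨_, by simp only [hm, hi.2, dif_pos]; rfl⟩

/-- The events that give pivot `i` a copy within the image of its window: no bit is deleted
(`none`), or just bit `j` is deleted and a run of equal bits extends from it beyond the end of the
pivot to which it is closer (`some (j, x)`, with `x` the value of the bits of the run). -/
def copyEvent (n LS L i : ℕ) : Option (Fin L × Bool) → (Fin n → Bool × Bool) → Prop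
  | none => Cylinder ∅ (bitRange n (pivotStart LS L i) (pivotStart LS L i + L)) ∅ true
  | some (j, x) => if L / 2 ≤ (j : ℕ) then
      Cylinder (bitRange n (pivotStart LS L i + j) (pivotStart LS L i + j + 1))
        (bitRange n (pivotStart LS L i) (pivotStart LS L i + L + 1) \
          bitRange n (pivotStart LS L i + j) (pivotStart LS L i + j + 1))
        (bitRange n (pivotStart LS L i + j) (pivotStart LS L i + L + 1)) x
    else
      Cylinder (bitRange n (pivotStart LS L i + j) (pivotStart LS L i + j + 1))
        (bitRange n (pivotStart LS L i - 1) (pivotStart LS L i + L) \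
          bitRange n (pivotStart LS L i + j) (pivotStart LS L i + j + 1))
        (bitRange n (pivotStart LS L i - 1) (pivotStart LS L i + j + 1)) x

/-- Since windows are disjoint, this makes the events of different pivots independent. -/
theorem dependsOn_copyEvent (i : ℕ) (c : Option (Fin L × Bool)) :
    DependsOn (copyEvent n LS L i c) (window n LS L i : Set (Fin n)) := by
  have hsub : ∀ a b, pivotStart LS L i - 1 ≤ a → b ≤ pivotStart LS L i + L + 1 →
      bitRange n a b ⊆ window n LS L i := by
    intro a b ha hb v hv
    rw [window, mem_bitRange]
    rw [mem_bitRange] at hv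
    omega
  match c with
  | none => exact dependsOn_cylinder (by simp) (hsub _ _ (by omega) (by omega)) (by simp)
  | some (j, x) =>
    have hj := j.2
    simp only [copyEvent]
    split_ifs
    · exact dependsOn_cylinder (hsub _ _ (by omega) (by omega))
        (Finset.sdiff_subset.trans (hsub _ _ (by omega) (by omega)))
        (hsub _ _ (by omega) (by omega))
    · exact dependsOn_cylinder (hsub _ _ (by omega) (by omega))
        (Finset.sdiff_subset.trans (hsub _ _ (by omega) (by omega)))
        (hsub _ _ (by omega) (by omega))

/-- On the side of `j` away from the run the copy uses the bits of the pivot themselves. Along the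
run it uses the bits shifted by one, the last of them being the neighbour just outside the pivot;
all bits of the run being equal, the shift does not show. -/
theorem hasLocalCopy_of_copyEvent {i : ℕ} (hLS : 1 ≤ LS) (hfit : pivotStart LS L i + L + 1 ≤ n)
    {c : Option (Fin L × Bool)} {ω : Fin n → Bool × Bool} (h : copyEvent n LS L i c ω) :
    HasLocalCopy LS L (fun v => (ω v).1) (fun v => (ω v).2) i := by
  set X : Fin n → Bool := fun v => (ω v).1 with hX
  set D : Fin n → Bool := fun v => (ω v).2 with hD
  have hp1 : 1 ≤ pivotStart LS L i := hLS.trans (pivotStart_ge LS L i)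
  set p := pivotStart LS L i with hp
  match c with
  | none =>
    obtain ⟨-, h0, -⟩ := h
    have hd : dels D p (p + L) = 0 := by
      rw [dels_eq_zero_iff]
      exact fun l h1 h2 => h0 l (mem_bitRange.mpr ⟨h1, h2⟩)
    refine ⟨rank D p, isCopyAt_rank_of_dels_eq_zero (by omega) hd, rank_mono D (by omega), ?_⟩
    have := rank_add_dels D (show p ≤ p + L by omega) (by omega)
    have := rank_mono D (show p + L ≤ p + L + 1 by omega)
    rw [← hp]
    omega
  | some (j, x) =>
    have hj := j.2
    have hjn : p + j < n := by omega
    simp only [copyEvent, ← hp] at h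
    split_ifs at h with hc
    · obtain ⟨h1, h0, hU⟩ := h
      have hkept : ∀ v : Fin n, p ≤ v → (v : ℕ) < p + L + 1 → (v : ℕ) ≠ p + j → D v = false := by
        intro v hv1 hv2 hv3
        refine h0 v ?_
        simp only [Finset.mem_sdiff, mem_bitRange]
        omega
      have hdj : dels D (p + j) (p + j + 1) = 1 :=
        dels_self_succ (v := ⟨p + j, hjn⟩) (h1 _ (by simp [mem_bitRange]))
      have hdl : ∀ w, w ≤ p + j → dels D p w = 0 := by
        intro w hw
        rw [dels_eq_zero_iff]
        exact fun l h1 h2 => hkept l h1 (by omega) (by omega)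
      have hdr : ∀ w, p + j + 1 ≤ w → w ≤ p + L + 1 → dels D p w = 1 := by
        intro w hw1 hw2
        rw [dels_add D (show p ≤ p + j by omega) (show p + j ≤ w by omega),
          dels_add D (show p + j ≤ p + j + 1 by omega) hw1, hdl _ le_rfl, hdj]
        have : dels D (p + j + 1) w = 0 := by
          rw [dels_eq_zero_iff]
          exact fun l h1 h2 => hkept l (by omega) (by omega) (by omega)
        omega
      refine ⟨rank D p, (isCopyAt_pivot_iff X D (by omega)).mpr fun w hw1 hw2 => ?_,
        rank_mono D (by omega), ?_⟩
      · rw [← hp] at hw1 hw2 ⊢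
        by_cases hwj : (w : ℕ) < p + j
        · have r := rank_add_dels D hw1 w.2.le
          rw [hdl w hwj.le] at r
          exact ⟨w, hkept w hw1 (by omega) (by omega), by omega, rfl⟩
        · have hw3 : (w : ℕ) + 1 < n := by omega
          have r := rank_add_dels D (show p ≤ (w : ℕ) + 1 by omega) hw3.le
          rw [hdr _ (by omega) (by omega)] at r
          refine ⟨⟨w + 1, hw3⟩, hkept _ (by simp only; omega) (by simp only; omega)
            (by simp only; omega), by simp only; omega, ?_⟩
          have e1 := hU w (mem_bitRange.mpr (by omega))
          have e2 := hU ⟨w + 1, hw3⟩ (mem_bitRange.mpr (by simp only; omega))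
          exact e2.trans e1.symm
      · have r := rank_add_dels D (show p ≤ p + L + 1 by omega) hfit
        rw [hdr _ (by omega) le_rfl] at r
        rw [← hp]
        omega
    · obtain ⟨h1, h0, hU⟩ := h
      have hkept : ∀ v : Fin n, p - 1 ≤ v → (v : ℕ) < p + L → (v : ℕ) ≠ p + j → D v = false := by
        intro v hv1 hv2 hv3
        refine h0 v ?_
        simp only [Finset.mem_sdiff, mem_bitRange]
        omega
      have hdj : dels D (p + j) (p + j + 1) = 1 :=
        dels_self_succ (v := ⟨p + j, hjn⟩) (h1 _ (by simp [mem_bitRange]))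
      have hdl : ∀ w, w ≤ p + j → dels D (p - 1) w = 0 := by
        intro w hw
        rw [dels_eq_zero_iff]
        exact fun l h1 h2 => hkept l h1 (by omega) (by omega)
      have hdr : ∀ w, p + j + 1 ≤ w → w ≤ p + L → dels D (p - 1) w = 1 := by
        intro w hw1 hw2
        rw [dels_add D (show p - 1 ≤ p + j by omega) (show p + j ≤ w by omega),
          dels_add D (show p + j ≤ p + j + 1 by omega) hw1, hdl _ le_rfl, hdj]
        have : dels D (p + j + 1) w = 0 := by
          rw [dels_eq_zero_iff]
          exact fun l h1 h2 => hkept l (by omega) (by omega) (by omega)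
        omega
      refine ⟨rank D (p - 1), (isCopyAt_pivot_iff X D (by omega)).mpr fun w hw1 hw2 => ?_,
        le_rfl, ?_⟩
      · rw [← hp] at hw1 hw2 ⊢
        by_cases hwj : (w : ℕ) ≤ p + j
        · have hw3 : (w : ℕ) - 1 < n := by omega
          have r := rank_add_dels D (show p - 1 ≤ (w : ℕ) - 1 by omega) hw3.le
          rw [hdl _ (by omega)] at r
          refine ⟨⟨w - 1, hw3⟩, hkept _ (by simp only; omega) (by simp only; omega)
            (by simp only; omega), by simp only; omega, ?_⟩
          have e1 := hU w (mem_bitRange.mpr (by omega))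
          have e2 := hU ⟨w - 1, hw3⟩ (mem_bitRange.mpr (by simp only; omega))
          exact e2.trans e1.symm
        · have r := rank_add_dels D (show p - 1 ≤ (w : ℕ) by omega) w.2.le
          rw [hdr w (by omega) (by omega)] at r
          exact ⟨w, hkept w (by omega) hw2 (by omega), by omega, rfl⟩
      · have r := rank_add_dels D (show p - 1 ≤ p + L by omega) (by omega)
        rw [hdr _ (by omega) le_rfl] at r
        have := rank_mono D (show p + L ≤ p + L + 1 by omega)
        rw [← hp]
        omega

/-- The deletions inside the pivot determine `j`, and the value of bit `j` determines `x`. The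
events are thus disjoint, and their probabilities add up. -/
theorem copyEvent_unique {i : ℕ} (hfit : pivotStart LS L i + L + 1 ≤ n)
    {c d : Option (Fin L × Bool)} {ω : Fin n → Bool × Bool} (hc : copyEvent n LS L i c ω)
    (hd : copyEvent n LS L i d ω) : c = d := by
  set p := pivotStart LS L i with hp
  have hnone : copyEvent n LS L i none ω → ∀ v : Fin n, p ≤ v → (v : ℕ) < p + L →
      (ω v).2 = false := fun h v h1 h2 => h.2.1 v (mem_bitRange.mpr ⟨h1, h2⟩)
  have hsome : ∀ (j : Fin L) (x : Bool) (hj : p + j < n), copyEvent n LS L i (some (j, x)) ω →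
      (ω ⟨p + j, hj⟩).1 = x ∧
        ∀ v : Fin n, p ≤ v → (v : ℕ) < p + L → ((ω v).2 = true ↔ (v : ℕ) = p + j) := by
    intro j x hj h
    have hjL := j.2
    simp only [copyEvent, ← hp] at h
    have key : ∀ K U, p - 1 ≤ p → Cylinder (bitRange n (p + j) (p + j + 1))
        (K \ bitRange n (p + j) (p + j + 1)) U x ω → bitRange n p (p + L) ⊆ K →
        ⟨p + j, hj⟩ ∈ U → (ω ⟨p + j, hj⟩).1 = x ∧
        ∀ v : Fin n, p ≤ v → (v : ℕ) < p + L → ((ω v).2 = true ↔ (v : ℕ) = p + j) := by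
      rintro K U - ⟨h1, h0, hU⟩ hK hjU
      refine ⟨hU _ hjU, fun v hv1 hv2 => ⟨fun hv => ?_, fun hv => ?_⟩⟩
      · by_contra hne
        have := h0 v (by
          rw [Finset.mem_sdiff, mem_bitRange]
          exact ⟨hK (mem_bitRange.mpr ⟨hv1, hv2⟩), by omega⟩)
        rw [hv] at this
        exact absurd this (by simp)
      · exact h1 v (mem_bitRange.mpr (by omega))
    split_ifs at h
    · refine key _ _ (by omega) h (fun v hv => ?_) (mem_bitRange.mpr (by simp only; omega))
      rw [mem_bitRange] at hv ⊢
      omega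
    · refine key _ _ (by omega) h (fun v hv => ?_) (mem_bitRange.mpr (by simp only; omega))
      rw [mem_bitRange] at hv ⊢
      omega
  have hlt : ∀ j : Fin L, p + j < n := fun j => by have := j.2; omega
  match c, d with
  | none, none => rfl
  | none, some (j, x) =>
    have h1 := hnone hc ⟨p + j, hlt j⟩ (by simp) (by simp)
    have h2 := ((hsome j x (hlt j) hd).2 ⟨p + j, hlt j⟩ (by simp) (by simp)).mpr rfl
    simp [h1] at h2
  | some (j, x), none =>
    have h1 := hnone hd ⟨p + j, hlt j⟩ (by simp) (by simp)
    have h2 := ((hsome j x (hlt j) hc).2 ⟨p + j, hlt j⟩ (by simp) (by simp)).mpr rfl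
    simp [h1] at h2
  | some (j, x), some (k, y) =>
    obtain ⟨hx, h1⟩ := hsome j x (hlt j) hc
    obtain ⟨hy, h2⟩ := hsome k y (hlt k) hd
    have h3 := (h1 ⟨p + j, hlt j⟩ (by simp) (by simp)).mpr rfl
    have h4 := (h2 ⟨p + j, hlt j⟩ (by simp) (by simp)).mp h3
    have hjk : j = k := Fin.ext (by simpa using h4)
    subst hjk
    rw [← hx, ← hy]

open Classical in
theorem prodExp_copyEvent_none {i : ℕ} (hfit : pivotStart LS L i + L + 1 ≤ n) (β : ℝ) :
    prodExp (bitWeight β) (fun ω => if copyEvent n LS L i none ω then (1 : ℝ) else 0) =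
      (1 - β) ^ L := by
  have h := prodExp_cylinder β (Finset.disjoint_empty_left
    (bitRange n (pivotStart LS L i) (pivotStart LS L i + L))) (U := ∅) true
  rw [card_bitRange (by omega)] at h
  exact h.trans (by simp)

-- The exponent of `1 / 2` is the length of the run, counting the deleted bit and the neighbour
-- outside the pivot.
open Classical in
theorem prodExp_copyEvent_some {i : ℕ} (hLS : 1 ≤ LS) (hfit : pivotStart LS L i + L + 1 ≤ n)
    (β : ℝ) (j : Fin L) (x : Bool) :
    prodExp (bitWeight β) (fun ω => if copyEvent n LS L i (some (j, x)) ω then (1 : ℝ) else 0) =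
      β * (1 - β) ^ L * (1 / 2) ^ (if L / 2 ≤ (j : ℕ) then L + 1 - j else j + 2) := by
  have hj := j.2
  have hp1 : 1 ≤ pivotStart LS L i := hLS.trans (pivotStart_ge LS L i)
  have hcard : ∀ a b, a ≤ pivotStart LS L i + j → pivotStart LS L i + j + 1 ≤ b → b ≤ n →
      (bitRange n a b \ bitRange n (pivotStart LS L i + j) (pivotStart LS L i + j + 1)).card =
        b - a - 1 := by
    intro a b ha hb hbn
    rw [Finset.card_sdiff_of_subset, card_bitRange hbn, card_bitRange (by omega)]
    · omega
    · intro v hv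
      rw [mem_bitRange] at hv ⊢
      omega
  have c1 : pivotStart LS L i + j + 1 - (pivotStart LS L i + j) = 1 := by omega
  by_cases h : L / 2 ≤ (j : ℕ)
  · have e : copyEvent n LS L i (some (j, x)) = Cylinder _ _ _ x := if_pos h
    rw [e, prodExp_cylinder β Finset.disjoint_sdiff, hcard _ _ (by omega) (by omega) (by omega),
      card_bitRange (by omega), card_bitRange (by omega), if_pos h, c1, pow_one,
      show pivotStart LS L i + L + 1 - pivotStart LS L i - 1 = L by omega,
      show pivotStart LS L i + L + 1 - (pivotStart LS L i + j) = L + 1 - j by omega]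
  · have e : copyEvent n LS L i (some (j, x)) = Cylinder _ _ _ x := if_neg h
    rw [e, prodExp_cylinder β Finset.disjoint_sdiff, hcard _ _ (by omega) (by omega) (by omega),
      card_bitRange (by omega), card_bitRange (by omega), if_neg h, c1, pow_one,
      show pivotStart LS L i + L - (pivotStart LS L i - 1) - 1 = L by omega,
      show pivotStart LS L i + j + 1 - (pivotStart LS L i - 1) = j + 2 by omega]

/-- Each half of the pivot gives a geometric series with limit one, after the two values of `x`
cancel a factor `1 / 2`. The limit 2 is the source of the term `2 * β` in the number of matched
pivots. -/
theorem sum_run_weights (L : ℕ) :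
    ∑ j : Fin L, ∑ _x : Bool, (1 / 2 : ℝ) ^ (if L / 2 ≤ (j : ℕ) then L + 1 - j else j + 2) =
      2 - (1 / 2) ^ (L / 2) - (1 / 2) ^ (L - L / 2) := by
  have hgeo : ∀ m : ℕ, ∑ j ∈ Finset.range m, (1 / 2 : ℝ) ^ (j + 1) = 1 - (1 / 2) ^ m := by
    intro m
    induction m with
    | zero => simp
    | succ m ih =>
      rw [Finset.sum_range_succ, ih]
      ring
  have hterm : ∀ j ∈ Finset.range L,
      ∑ _x : Bool, (1 / 2 : ℝ) ^ (if L / 2 ≤ j then L + 1 - j else j + 2) =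
      if L / 2 ≤ j then (1 / 2 : ℝ) ^ (L - j) else (1 / 2) ^ (j + 1) := by
    intro j hj
    rw [Finset.mem_range] at hj
    rw [Finset.sum_const, Finset.card_univ, Fintype.card_bool]
    split_ifs
    · rw [show L + 1 - j = (L - j) + 1 by omega, pow_succ]
      ring
    · rw [show j + 2 = (j + 1) + 1 by omega, pow_succ]
      ring
  rw [Fin.sum_univ_eq_sum_range (fun j => ∑ _x : Bool,
    (1 / 2 : ℝ) ^ (if L / 2 ≤ j then L + 1 - j else j + 2)) L, Finset.sum_congr rfl hterm,
    ← Finset.sum_range_add_sum_Ico _ (show L / 2 ≤ L by omega)]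
  have e1 : ∑ j ∈ Finset.range (L / 2),
      (if L / 2 ≤ j then (1 / 2 : ℝ) ^ (L - j) else (1 / 2) ^ (j + 1)) = 1 - (1 / 2) ^ (L / 2) := by
    rw [← hgeo]
    refine Finset.sum_congr rfl fun j hj => ?_
    rw [Finset.mem_range] at hj
    rw [if_neg (by omega)]
  have e2 : ∑ j ∈ Finset.Ico (L / 2) L,
      (if L / 2 ≤ j then (1 / 2 : ℝ) ^ (L - j) else (1 / 2) ^ (j + 1)) =
        1 - (1 / 2) ^ (L - L / 2) := by
    rw [← hgeo, Finset.sum_Ico_eq_sum_range, ← Finset.sum_range_reflect]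
    refine Finset.sum_congr rfl fun j hj => ?_
    rw [Finset.mem_range] at hj
    rw [if_pos (by omega)]
    congr 1
    omega
  rw [e1, e2]
  ring

open Classical in
theorem prodExp_no_copyEvent_le {i : ℕ} (hLS : 1 ≤ LS) (hfit : pivotStart LS L i + L + 1 ≤ n)
    {β : ℝ} (hβ0 : 0 ≤ β) (hβ1 : β ≤ 1) :
    prodExp (bitWeight β) (fun ω => if ¬ ∃ c, copyEvent n LS L i c ω then (1 : ℝ) else 0) ≤
      1 - (1 - β) ^ L * (1 + β * (2 - (1 / 2) ^ (L / 2) - (1 / 2) ^ (L - L / 2))) := by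
  have hpt : ∀ ω : Fin n → Bool × Bool, (if ¬ ∃ c, copyEvent n LS L i c ω then (1 : ℝ) else 0) +
      ∑ c, (if copyEvent n LS L i c ω then (1 : ℝ) else 0) ≤ 1 := by
    intro ω
    by_cases h : ∃ c, copyEvent n LS L i c ω
    · obtain ⟨c, hc⟩ := h
      have : ∑ c, (if copyEvent n LS L i c ω then (1 : ℝ) else 0) = 1 := by
        rw [Finset.sum_eq_single c]
        · simp [hc]
        · intro d _ hd
          rw [if_neg]
          exact fun hd' => hd (copyEvent_unique hfit hd' hc)
        · simp
      rw [this, if_neg (not_not.mpr ⟨c, hc⟩), zero_add]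
    · rw [Finset.sum_eq_zero fun c _ => if_neg fun hc => h ⟨c, hc⟩, if_pos h, add_zero]
  have h := prodExp_mono (bitWeight_nonneg hβ0 hβ1) hpt
  rw [prodExp_add, prodExp_sum, prodExp_one (sum_bitWeight β), Fintype.sum_option,
    prodExp_copyEvent_none hfit, Fintype.sum_prod_type] at h
  simp only [prodExp_copyEvent_some hLS hfit] at h
  simp only [← Finset.mul_sum] at h
  rw [sum_run_weights] at h
  linarith

open Classical in
/-- With overwhelming probability, nearly the expected number of pivots can be matched. -/
theorem channelProb_few_local_copies_le (hl : Layout n LS L N) {β : ℝ} (hβ0 : 0 ≤ β)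
    (hβ1 : β ≤ 1) {q δ : ℝ} (hq1 : q ≤ 1) (hδ0 : 0 < δ) (hδ1 : δ ≤ 1)
    (hq : 1 - (1 - β) ^ L * (1 + β * (2 - (1 / 2) ^ (L / 2) - (1 / 2) ^ (L - L / 2))) ≤ q) :
    channelProb n β (fun X D => ((matchedSet (answer LS L N X D)).card : ℝ) ≤ (1 - q - δ) * N) ≤
      Real.exp (-(N * δ ^ 2 / 4)) := by
  have hfit : ∀ i : Fin N, pivotStart LS L i + L + 1 ≤ n := fun i => by
    have := hl.fit i i.2
    have := hl.two_le
    omega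
  have hLS : 1 ≤ LS := by
    have := hl.two_le
    omega
  obtain ⟨A, hA⟩ : ∃ A : Fin N → (Fin n → Bool × Bool) → Prop,
    A = fun (i : Fin N) ω => ¬ ∃ c, copyEvent n LS L (i : ℕ) c ω := ⟨_, rfl⟩
  have hch := prodExp_card_ge_le (κ := Fin N) (bitWeight_nonneg hβ0 hβ1) (sum_bitWeight β)
    A (fun i => window n LS L i)
    (fun i ω ω' h => by
      rw [hA]
      refine propext (not_congr (exists_congr fun c => ?_))
      rw [dependsOn_copyEvent i c h])
    (fun i j hij => disjoint_window hl.two_le fun h => hij (Fin.ext h)) hq1 hδ0 hδ1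
    (fun i => by
      refine le_trans (le_of_eq ?_) ((prodExp_no_copyEvent_le hLS (hfit i) hβ0 hβ1).trans hq)
      congr 1
      funext ω
      refine if_congr ?_ rfl rfl
      rw [hA])
  rw [Fintype.card_fin] at hch
  rw [channelProb_eq_prodExp]
  refine le_trans (prodExp_mono (bitWeight_nonneg hβ0 hβ1) fun ω => ?_) hch
  by_cases h : ((matchedSet (answer LS L N (fun v => (ω v).1) (fun v => (ω v).2))).card : ℝ) ≤
    (1 - q - δ) * N
  · have hsub : (Finset.univ.filter (fun i : Fin N => ¬ A i ω)).card ≤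
        (matchedSet (answer LS L N (fun v => (ω v).1) (fun v => (ω v).2))).card := by
      refine le_trans (Finset.card_le_card fun i hi => ?_) (card_hasLocalCopy_le hl _ _)
      rw [Finset.mem_filter, hA] at hi
      rw [Finset.mem_filter]
      obtain ⟨c, hc⟩ := not_not.mp hi.2
      refine ⟨Finset.mem_univ _, ?_⟩
      exact hasLocalCopy_of_copyEvent hLS (hfit i) hc
    have hadd := Finset.card_filter_add_card_filter_not (s := (Finset.univ : Finset (Fin N)))
      (fun i => A i ω)
    rw [Finset.card_univ, Fintype.card_fin] at hadd
    have hadd' : ((Finset.univ.filter (fun i : Fin N => A i ω)).card : ℝ) +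
        ((Finset.univ.filter (fun i : Fin N => ¬ A i ω)).card : ℝ) = N := by
      exact_mod_cast hadd
    have hsub' : ((Finset.univ.filter (fun i : Fin N => ¬ A i ω)).card : ℝ) ≤
        ((matchedSet (answer LS L N (fun v => (ω v).1) (fun v => (ω v).2))).card : ℝ) := by
      exact_mod_cast hsub
    rw [if_pos h, if_pos]
    linarith
  · rw [if_neg h]
    split_ifs
    · norm_num
    · norm_num

/-- Two deletions in a pivot are unlikely. -/
theorem channelProb_two_le_pivotDeletions_le {β : ℝ} (hβ0 : 0 < β) (hβ1 : β ≤ 1) (hL : 1 ≤ L)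
    (hLβ : L * β ≤ 1) (i : ℕ) :
    channelProb n β (fun _ D => 2 ≤ pivotDeletions LS L D i) ≤ Real.exp 1 * (L * β) ^ 2 := by
  classical
  have hL0 : (0 : ℝ) < L := by exact_mod_cast hL
  have hpos : 0 < L * β := by positivity
  -- Base for Markov's inequality: the expected number of deletions is at most `L * β = 1 / y`, so
  -- the expectation of `y` to this number is at most `exp 1`.
  set y : ℝ := (L * β)⁻¹ with hy
  have hy1 : 1 ≤ y := (one_le_inv₀ hpos).mpr hLβ
  set J := bitRange n (pivotStart LS L i) (pivotStart LS L i + L) with hJ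
  have hJL : (J.card : ℝ) ≤ L := by
    have : J.card ≤ L := (card_bitRange_le _ _ _).trans (by omega)
    exact_mod_cast this
  have hdel : ∀ D : Fin n → Bool, pivotDeletions LS L D i =
      (J.filter (fun j => D j = true)).card := by
    intro D
    rw [hJ, bitRange, Finset.filter_filter]
    simp only [and_assoc]
    rfl
  rw [channelProb_eq_sum_card]
  calc _ ≤ ∑ D : Fin n → Bool, (∏ j, (if D j = true then β else 1 - β)) *
        ((y⁻¹) ^ 2 * y ^ (J.filter (fun j => D j = true)).card) := by
        refine Finset.sum_le_sum fun D _ => mul_le_mul_of_nonneg_left ?_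
          (Finset.prod_nonneg fun j _ => by split_ifs <;> linarith)
        by_cases h : 2 ≤ pivotDeletions LS L D i
        · refine le_trans (le_of_eq (by simp [h] : _ = (1 : ℝ))) ?_
          rw [inv_pow, ← div_eq_inv_mul, one_le_div (by positivity)]
          rw [hdel] at h
          exact pow_le_pow_right₀ hy1 h
        · simp only [h, Finset.filter_false, Finset.card_empty, Nat.cast_zero, mul_zero]
          positivity
    _ = (y⁻¹) ^ 2 * ∑ D : Fin n → Bool, (∏ j, (if D j = true then β else 1 - β)) *
        y ^ (J.filter (fun j => D j = true)).card := by
        rw [Finset.mul_sum]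
        exact Finset.sum_congr rfl fun D _ => by ring
    _ = (y⁻¹) ^ 2 * (1 - β + β * y) ^ J.card := by rw [sum_weight_mul_pow_card]
    _ ≤ (y⁻¹) ^ 2 * Real.exp 1 := by
        gcongr
        have h0 : 0 ≤ β * y := by positivity
        calc (1 - β + β * y) ^ J.card ≤ Real.exp (β * y) ^ J.card := by
              have := Real.add_one_le_exp (β * y)
              gcongr
              linarith
          _ = Real.exp (J.card * (β * y)) := (Real.exp_nat_mul _ _).symm
          _ ≤ Real.exp 1 := by
              rw [Real.exp_le_exp]
              calc (J.card : ℝ) * (β * y) ≤ L * (β * y) := by gcongr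
                _ = 1 := by
                    rw [hy]
                    field_simp
    _ = _ := by
        rw [hy, inv_inv]
        ring

open Classical in
theorem channelProb_many_two_deletions_le (hl : Layout n LS L N) {β : ℝ} (hβ0 : 0 < β)
    (hβ1 : β ≤ 1) (hLβ : L * β ≤ 1) {q δ : ℝ} (hq1 : q ≤ 1) (hδ0 : 0 < δ) (hδ1 : δ ≤ 1)
    (hq : Real.exp 1 * (L * β) ^ 2 ≤ q) :
    channelProb n β (fun _ D => (q + δ) * N ≤
      ((Finset.univ.filter (fun i : Fin N => 2 ≤ pivotDeletions LS L D i)).card : ℝ)) ≤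
      Real.exp (-(N * δ ^ 2 / 4)) := by
  have hch := prodExp_card_ge_le (κ := Fin N) (bitWeight_nonneg hβ0.le hβ1) (sum_bitWeight β)
    (fun i (ω : Fin n → Bool × Bool) => 2 ≤ pivotDeletions LS L (fun v => (ω v).2) i)
    (fun i => window n LS L i)
    (fun i ω ω' h => by
      have : pivotDeletions LS L (fun v => (ω v).2) i =
          pivotDeletions LS L (fun v => (ω' v).2) i := by
        unfold pivotDeletions
        congr 1
        refine Finset.filter_congr fun v _ => and_congr_right fun h1 => and_congr_right fun h2 => ?_
        change (ω v).2 = true ↔ (ω' v).2 = true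
        rw [h v (by
          rw [Finset.mem_coe, window, mem_bitRange]
          omega)]
      simp only [this])
    (fun i j hij => disjoint_window hl.two_le fun h => hij (Fin.ext h)) hq1 hδ0 hδ1
    (fun i => by
      have := channelProb_two_le_pivotDeletions_le (n := n) (LS := LS) hβ0 hβ1 hl.one_le hLβ i
      rw [channelProb_eq_prodExp] at this
      exact this.trans hq)
  rw [Fintype.card_fin] at hch
  rw [channelProb_eq_prodExp]
  convert hch

end Nice

theorem layout_numSegments {n LS L : ℕ} (hLS : 2 ≤ LS) (hL : 1 ≤ L) :
    Layout n LS L (numSegments n LS L - 1) where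
  two_le := hLS
  one_le := hL
  fit i hi := by
    unfold numSegments at hi
    have h1 := Nat.div_mul_le_self (n + L) (LS + L)
    have h2 : (i + 2) * (LS + L) ≤ (n + L) / (LS + L) * (LS + L) :=
      Nat.mul_le_mul_right _ (by omega)
    unfold pivotStart
    nlinarith
  short i hi := by
    unfold numSegments at hi
    have h1 := Nat.lt_mul_div_succ (n + L) (show 0 < LS + L by omega)
    have h2 : (n + L) / (LS + L) + 1 = i + 3 := by omega
    rw [h2] at h1
    unfold pivotStart
    nlinarith

/-! ### From the maximum matching to the module. -/

section MaxModule

variable {n LS L N K : ℕ}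

theorem numMatched_maxModule {X D : Fin n → Bool}
    (h : K ≤ (matchedSet (answer LS L N X D)).card) :
    (maxModule N K).numMatched LS L X D = K := by
  refine Eq.trans ?_ (card_matchedSet_truncatedMax h)
  rw [← Set.ncard_coe_finset]
  unfold MatchingModule.numMatched
  congr 1
  ext i
  rw [Finset.mem_coe, mem_matchedSet]
  rfl

theorem strayAt_or_of_wrongAt {X D : Fin n → Bool} {i : Fin N}
    (h : (maxModule N K).WrongAt LS L X D i) :
    StrayAt LS L N X D i ∨ 2 ≤ pivotDeletions LS L D i := by
  obtain ⟨q, hq, hc⟩ := h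
  by_cases h2 : 2 ≤ pivotDeletions LS L D i
  · exact Or.inr h2
  · exact Or.inl ⟨q, truncatedMax_eq_some hq, hc, by omega⟩

open Classical in
theorem numWrong_maxModule_le (X D : Fin n → Bool) :
    (maxModule N K).numWrong LS L X D ≤
      (Finset.univ.filter (fun i : Fin N => StrayAt LS L N X D i)).card +
        (Finset.univ.filter (fun i : Fin N => 2 ≤ pivotDeletions LS L D i)).card := by
  refine le_trans ?_ (Finset.card_union_le _ _)
  rw [← Set.ncard_coe_finset]
  refine Set.ncard_le_ncard (fun i hi => ?_) (Finset.finite_toSet _)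
  rw [Finset.mem_coe, Finset.mem_union, Finset.mem_filter, Finset.mem_filter]
  rcases strayAt_or_of_wrongAt hi with h | h
  · exact Or.inl ⟨Finset.mem_univ _, h⟩
  · exact Or.inr ⟨Finset.mem_univ _, h⟩

end MaxModule

/-! ### Numerical estimates and the choice of constants. -/

theorem exp_five_le : Real.exp 5 ≤ 150 := by
  have h := Real.exp_one_lt_d9
  have h5 : Real.exp 5 = Real.exp 1 ^ 5 := by
    rw [← Real.exp_nat_mul]
    norm_num
  rw [h5]
  calc Real.exp 1 ^ 5 ≤ (2.7182818286 : ℝ) ^ 5 := by gcongr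
    _ ≤ 150 := by norm_num

theorem one_sub_copy_weight_le {β : ℝ} {L : ℕ} (hβ0 : 0 < β) (hβ1 : β ≤ 1)
    (hhalf : (1 / 2 : ℝ) ^ (L / 2) ≤ β) :
    1 - (1 - β) ^ L * (1 + β * (2 - (1 / 2) ^ (L / 2) - (1 / 2) ^ (L - L / 2))) ≤
      L * β - 2 * β + 2 * (L + 1) * β ^ 2 := by
  have h1 : (1 : ℝ) - L * β ≤ (1 - β) ^ L := by
    have := one_add_mul_le_pow (show (-2 : ℝ) ≤ -β by linarith) L
    calc (1 : ℝ) - L * β = 1 + L * -β := by ring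
      _ ≤ (1 + -β) ^ L := this
      _ = (1 - β) ^ L := by ring
  have h2 : (1 / 2 : ℝ) ^ (L - L / 2) ≤ β :=
    (pow_le_pow_of_le_one (by norm_num) (by norm_num) (by omega)).trans hhalf
  have h3 : 1 + β * (2 - 2 * β) ≤
      1 + β * (2 - (1 / 2) ^ (L / 2) - (1 / 2) ^ (L - L / 2)) :=
    add_le_add le_rfl (mul_le_mul_of_nonneg_left (by linarith) hβ0.le)
  have h4 : (1 - L * β) * (1 + β * (2 - 2 * β)) ≤
      (1 - β) ^ L * (1 + β * (2 - (1 / 2) ^ (L / 2) - (1 / 2) ^ (L - L / 2))) := by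
    refine mul_le_mul h1 h3 ?_ (pow_nonneg (by linarith) _)
    have : 0 ≤ β * (2 - 2 * β) := mul_nonneg hβ0.le (by linarith)
    linarith
  have h5 : 0 ≤ (L : ℝ) * β ^ 3 := by positivity
  nlinarith

/-- A segment and a pivot together have length at most `2 / β`, so `k` is at least `n * β / 2 - 1`.
The lower bound on `n` makes `β ^ 2 * k` at least one, which later absorbs rounding. -/
theorem numSegments_bounds {β : ℝ} {n LS L : ℕ} (hβ0 : 0 < β) (hβ1 : β ≤ 1 / 60000)
    (hLβ : ((L : ℝ) + 2) * β ≤ 1 / 2) (hLS : 1 ≤ LS) (hLSle : (LS : ℝ) ≤ 1 / β + 1)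
    (hn : 64 / β ^ 5 ≤ (n : ℝ)) :
    1 ≤ numSegments n LS L ∧ (60000 : ℝ) ≤ numSegments n LS L ∧
      1 ≤ β ^ 2 * numSegments n LS L ∧
      (n : ℝ) * β / 4 ≤ ((numSegments n LS L - 1 : ℕ) : ℝ) := by
  set k := numSegments n LS L with hk
  obtain ⟨z, hz⟩ : ∃ z, z = 1 / β := ⟨_, rfl⟩
  have hzβ : z * β = 1 := by
    rw [hz]
    field_simp
  have hz1 : 60000 ≤ z := by
    rw [hz, le_div_iff₀ hβ0]
    linarith
  have hnz : 64 * z ^ 4 ≤ n * β := by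
    have h5 : 64 / β ^ 5 = 64 * z ^ 5 := by
      rw [hz, one_div, inv_pow, div_eq_mul_inv]
    rw [h5] at hn
    calc 64 * z ^ 4 = 64 * z ^ 4 * (z * β) := by rw [hzβ, mul_one]
      _ = 64 * z ^ 5 * β := by ring
      _ ≤ n * β := by gcongr
  have hz2 : 60000 ≤ z ^ 2 := by nlinarith
  have hz4 : 60000 * z ^ 2 ≤ z ^ 4 := by
    calc 60000 * z ^ 2 ≤ z ^ 2 * z ^ 2 := by gcongr
      _ = z ^ 4 := by ring
  have hkn : (n : ℝ) * β / 2 - 1 ≤ k := by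
    have h1 := Nat.lt_mul_div_succ (n + L) (show 0 < LS + L by omega)
    have h2 : ((n : ℝ) + L) < (LS + L) * (k + 1) := by exact_mod_cast h1
    have h3 : ((LS : ℝ) + L) * β ≤ 2 := by
      calc ((LS : ℝ) + L) * β ≤ (z + 1 + L) * β := by
            rw [← hz] at hLSle
            gcongr
        _ = 1 + (1 + L) * β := by rw [← hzβ]; ring
        _ ≤ 2 := by nlinarith
    have h5 : (n : ℝ) * β ≤ 2 * (k + 1) := by
      calc (n : ℝ) * β ≤ ((LS + L) * (k + 1)) * β := by
            have : (0 : ℝ) ≤ L := by positivity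
            gcongr
            linarith
        _ = ((LS + L) * β) * (k + 1) := by ring
        _ ≤ 2 * (k + 1) := by gcongr
    linarith
  have hkz : z ^ 2 ≤ k := by linarith
  have hkbig : (60000 : ℝ) ≤ k := by linarith
  have hk1 : 1 ≤ k := by
    have : (1 : ℝ) ≤ k := by linarith
    exact_mod_cast this
  refine ⟨hk1, hkbig, ?_, ?_⟩
  · calc 1 = β ^ 2 * z ^ 2 := by rw [← mul_pow, mul_comm, hzβ, one_pow]
      _ ≤ β ^ 2 * k := by gcongr
  · rw [Nat.cast_sub hk1, Nat.cast_one]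
    linarith

/-- The slowest rate is `β ^ 4 / 4` per pivot, that is `β ^ 5 / 16` per bit of the file. Half of it
pays for there being three terms: `β ^ 5 / 32 * n` is at least 2, so its exponential is at least 3.
-/
theorem failure_bounds_le {β n N : ℝ} (hβ0 : 0 < β) (hβ1 : β ≤ 1 / 60000) (hN0 : 0 ≤ N)
    (hNn : n * β / 4 ≤ N) (hn : 64 / β ^ 5 ≤ n) :
    Real.exp (-(N * (β ^ 2) ^ 2 / 4)) +
      (Real.exp (N * (Real.exp 1 * (β / 13) * ((1 - 1 / 10)⁻¹) ^ 2) - β / 2 * N) +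
        Real.exp (-(N * (β / 8) ^ 2 / 4))) ≤ (2 : ℝ) ^ (-(β ^ 5 / 32 * n)) := by
  have he1 : Real.exp 1 ≤ 2.7182818286 := Real.exp_one_lt_d9.le
  have hβsq : β ^ 2 ≤ β / 60000 := by nlinarith
  have hβ5 : 64 ≤ n * β ^ 5 := by
    rwa [div_le_iff₀ (by positivity)] at hn
  have hT : ∀ t : ℝ, β ^ 4 / 4 * N ≤ t → Real.exp (-t) ≤ Real.exp (-(β ^ 5 / 16 * n)) := by
    intro t ht
    rw [Real.exp_le_exp, neg_le_neg_iff]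
    refine le_trans ?_ ht
    calc β ^ 5 / 16 * n = β ^ 4 / 4 * (n * β / 4) := by ring
      _ ≤ _ := by gcongr
  have hβ4 : β ^ 4 ≤ β ^ 2 / 64 := by
    have : β ^ 2 ≤ 1 / 64 := by linarith
    calc β ^ 4 = β ^ 2 * β ^ 2 := by ring
      _ ≤ β ^ 2 * (1 / 64) := by gcongr
      _ = β ^ 2 / 64 := by ring
  have t1 := hT (N * (β ^ 2) ^ 2 / 4) (le_of_eq (by ring))
  have t3 := hT (N * (β / 8) ^ 2 / 4) (by nlinarith)
  have t2 : Real.exp (N * (Real.exp 1 * (β / 13) * ((1 - 1 / 10)⁻¹) ^ 2) - β / 2 * N) ≤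
      Real.exp (-(β ^ 5 / 16 * n)) := by
    have h1 : Real.exp 1 * (β / 13) * ((1 - 1 / 10)⁻¹) ^ 2 ≤ 3 / 10 * β := by
      calc Real.exp 1 * (β / 13) * ((1 - 1 / 10)⁻¹) ^ 2 ≤
            2.7182818286 * (β / 13) * ((1 - 1 / 10)⁻¹) ^ 2 := by
            gcongr
        _ ≤ 3 / 10 * β := by
            norm_num
            linarith
    have h2 : N * (Real.exp 1 * (β / 13) * ((1 - 1 / 10)⁻¹) ^ 2) ≤ N * (3 / 10 * β) := by gcongr
    have h3 := hT (β / 5 * N) (by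
      have : β ^ 4 / 4 ≤ β / 5 := by linarith
      gcongr)
    refine le_trans ?_ h3
    rw [Real.exp_le_exp]
    linarith
  have hthree : 3 * Real.exp (-(β ^ 5 / 16 * n)) ≤ (2 : ℝ) ^ (-(β ^ 5 / 32 * n)) := by
    have h3 : (3 : ℝ) ≤ Real.exp (β ^ 5 / 32 * n) := by
      have := Real.add_one_le_exp (β ^ 5 / 32 * n)
      linarith
    calc 3 * Real.exp (-(β ^ 5 / 16 * n)) ≤
          Real.exp (β ^ 5 / 32 * n) * Real.exp (-(β ^ 5 / 16 * n)) := by gcongr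
      _ = Real.exp (-(β ^ 5 / 32 * n)) := by
          rw [← Real.exp_add]
          congr 1
          ring
      _ ≤ (2 : ℝ) ^ (-(β ^ 5 / 32 * n)) := by
          rw [Real.rpow_def_of_pos (by norm_num), Real.exp_le_exp]
          have : Real.log 2 ≤ 1 := by
            have := Real.log_two_lt_d9
            linarith
          have : 0 ≤ β ^ 5 / 32 * n := by linarith
          nlinarith
  linarith

set_option maxHeartbeats 1000000 in
/-- The matching theorem for given parameters. -/
theorem exists_good_module {β : ℝ} {L n : ℕ} (hβ0 : 0 < β) (hL : 2 ≤ L)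
    (hsmall : ((L : ℝ) + 2) * Real.sqrt β ≤ 1 / 15000) (hpow : (1 / 2 : ℝ) ^ L ≤ β ^ 2 / 2048)
    (hhalf : (1 / 2 : ℝ) ^ (L / 2) ≤ β) (hn : 64 / β ^ 5 ≤ (n : ℝ)) :
    ∃ (k' : ℕ) (M : MatchingModule (numSegments n (segLength β) L - 1)),
      |(k' : ℝ) - (1 - L * β + 2 * β) * (numSegments n (segLength β) L : ℝ)|
          ≤ (β * Real.sqrt β) * (numSegments n (segLength β) L : ℝ) ∧
      1 - (2 : ℝ) ^ (-(β ^ 5 / 32 * (n : ℝ))) ≤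
        channelProb n β (fun X D =>
          M.numMatched (segLength β) L X D + 1 = k' ∧
          (M.numWrong (segLength β) L X D : ℝ)
            ≤ β * (M.numMatched (segLength β) L X D : ℝ)) ∧
      ∀ i, channelProb n β (fun X D => M.WrongAt (segLength β) L X D i) ≤ β := by
  classical
  set r := Real.sqrt β with hr
  have hr0 : 0 < r := Real.sqrt_pos.mpr hβ0
  have hrr : r * r = β := Real.mul_self_sqrt hβ0.le
  have hLr : (2 : ℝ) ≤ L := by exact_mod_cast hL
  have hr1 : r ≤ 1 / 60000 := by nlinarith
  have hβr : β ≤ r / 60000 := by nlinarith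
  have hβ1 : β ≤ 1 / 60000 := by linarith
  have hβle : β ≤ 1 := by linarith
  have hLβ : ((L : ℝ) + 2) * β ≤ 1 / 15000 * r := by
    calc ((L : ℝ) + 2) * β = ((L + 2) * r) * r := by rw [← hrr]; ring
      _ ≤ 1 / 15000 * r := by gcongr
  have hLβ' : ((L : ℝ) + 2) * β ≤ 1 / 15000 := by linarith
  set LS := segLength β with hLSdef
  have hLSge : 1 / β ≤ (LS : ℝ) := Nat.le_ceil _
  have hLSle : (LS : ℝ) ≤ 1 / β + 1 := (Nat.ceil_lt_add_one (by positivity)).le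
  have hβLS : β * (LS : ℝ) ≤ 1 + β := by
    calc β * (LS : ℝ) ≤ β * (1 / β + 1) := by gcongr
      _ = 1 + β := by field_simp
  have hLS2 : 2 ≤ LS := by
    have : (2 : ℝ) ≤ LS := by
      refine le_trans ?_ hLSge
      rw [le_div_iff₀ hβ0]
      linarith
    exact_mod_cast this
  set k := numSegments n LS L with hk
  set N := k - 1 with hN
  have hl : Layout n LS L N := layout_numSegments hLS2 (by omega)
  have hrange : β * (3 * ((LS : ℝ) + L) + 3) ≤ 4 := by linarith
  have he5 := exp_five_le
  have he1 : Real.exp 1 ≤ 2.7182818286 := Real.exp_one_lt_d9.le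
  -- By `hpow` and `exp 5 ≤ 150` a stray costs at most `150 / 2048 * β`, and `150 / 2048 < 1 / 13`.
  set b := β / 13 with hb
  have hbbound : Real.exp 5 * ((1 / 2) ^ L / β) ≤ b := by
    calc Real.exp 5 * ((1 / 2) ^ L / β) ≤ 150 * ((β ^ 2 / 2048) / β) := by gcongr
      _ = 150 / 2048 * β := by field_simp
      _ ≤ b := by
          rw [hb]
          linarith
  have ha : ((L : ℝ) + 2) * β * Real.exp 5 ≤ (1 / 10) ^ 2 := by
    calc ((L : ℝ) + 2) * β * Real.exp 5 ≤ 1 / 15000 * 150 := by gcongr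
      _ = (1 / 10) ^ 2 := by norm_num
  have hLββ : Real.exp 1 * (L * β) ^ 2 ≤ β / 8 := by
    have h1 : (L : ℝ) * β ≤ 1 / 15000 * r := by linarith
    calc Real.exp 1 * (L * β) ^ 2 ≤ 2.7182818286 * (1 / 15000 * r) ^ 2 := by gcongr
      _ = 2.7182818286 / 15000 ^ 2 * β := by
          rw [← hrr]
          ring
      _ ≤ β / 8 := by linarith
  obtain ⟨hk1, hkbig, hone, hNn⟩ := numSegments_bounds (L := L) hβ0 hβ1 (by linarith)
    (by omega) hLSle hn
  rw [← hk] at hk1 hkbig hone hNn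
  rw [← hN] at hNn
  have hNk : (N : ℝ) = k - 1 := by
    rw [hN, Nat.cast_sub hk1, Nat.cast_one]
  set q := L * β - 2 * β + 2 * (L + 1) * β ^ 2 with hq
  -- The fraction of pivots that can be matched: `q` bounds the probability that a pivot has no copy
  -- event, and `β ^ 2` is the margin in the Chernoff bound.
  set ρ := 1 - q - β ^ 2 with hρ
  have hrβ : r * β ≤ 1 / 60000 * β := by gcongr
  have hLβ2 : ((L : ℝ) + 2) * β ^ 2 ≤ 1 / 15000 * (r * β) := by
    calc ((L : ℝ) + 2) * β ^ 2 = ((L + 2) * β) * β := by ring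
      _ ≤ (1 / 15000 * r) * β := by gcongr
      _ = _ := by ring
  have hLβ3 : ((L : ℝ) + 2) * β ^ 2 ≤ 1 / 15000 * β := by linarith
  have hLβ0 : 0 ≤ (L - 2) * β := mul_nonneg (by linarith) hβ0.le
  have hq0 : 0 ≤ q := by
    have : 0 ≤ ((L : ℝ) + 1) * β ^ 2 := by positivity
    linarith
  have hβ2 : 0 ≤ β ^ 2 := by positivity
  have hq1 : q ≤ 1 / 10 := by linarith
  have hqL : L * β ≤ 1 := by linarith
  have hβsq : β ^ 2 ≤ β / 60000 := by
    calc β ^ 2 = β * β := sq β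
      _ ≤ β * (1 / 60000) := by gcongr
      _ = β / 60000 := by ring
  have hρ1 : ρ ≤ 1 := by linarith
  have hρ0 : 8 / 10 ≤ ρ := by linarith
  have hqbound := one_sub_copy_weight_le hβ0 hβle hhalf
  set k' := ⌊ρ * k⌋₊ with hk'
  have hρk : 0 ≤ ρ * k := by positivity
  have hk'le : (k' : ℝ) ≤ ρ * k := Nat.floor_le hρk
  have hk'ge : ρ * k - 1 ≤ k' := by
    have := Nat.lt_floor_add_one (ρ * (k : ℝ))
    linarith
  have hρk8 : 8 / 10 * (k : ℝ) ≤ ρ * k := by gcongr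
  have hk'1 : 1 ≤ k' := by
    have : (1 : ℝ) ≤ k' := by linarith
    exact_mod_cast this
  have hK : ((k' - 1 : ℕ) : ℝ) = k' - 1 := by
    rw [Nat.cast_sub hk'1, Nat.cast_one]
  refine ⟨k', maxModule N (k' - 1), ?_, ?_, fun i => ?_⟩
  · rw [abs_le]
    have e1 : (1 - L * β + 2 * β) * (k : ℝ) = ρ * k + (2 * (L + 1) * β ^ 2 + β ^ 2) * k := by
      rw [hρ, hq]
      ring
    -- The last `β ^ 2` pays for the rounding in `k'`, as `1 ≤ β ^ 2 * k`. The whole error is of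
    -- order `L * β ^ 2`, which is below `β * r` because `(L + 2) * r` is small.
    have h1 : (2 * (L + 1) * β ^ 2 + β ^ 2) + β ^ 2 ≤ β * r := by
      have : 0 ≤ r * β := by positivity
      linarith
    have h2 : ((2 * (L + 1) * β ^ 2 + β ^ 2) + β ^ 2) * (k : ℝ) ≤ β * r * k := by gcongr
    have h3 : 0 ≤ (2 * (L + 1) * β ^ 2 + β ^ 2) * (k : ℝ) := by positivity
    have h4 : 0 ≤ β * r * (k : ℝ) := by positivity
    rw [e1]
    constructor
    · linarith
    · linarith
  · have hf1 := channelProb_few_local_copies_le hl hβ0.le hβle (q := q) (δ := β ^ 2)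
      (by linarith) (by positivity) (by linarith) hqbound
    have hf2 := channelProb_card_stray_ge_le hl hβ0 hβle hrange (by linarith)
      (s := 1 / 10) (b := b) (by norm_num) (by norm_num) ha hbbound (β / 2 * N)
    have hf3 := channelProb_many_two_deletions_le hl hβ0 hβle hqL
      (q := β / 8) (δ := β / 8) (by linarith) (by positivity) (by linarith) hLββ
    have hcompl := one_le_channelProb_add_not (n := n) β (fun X D =>
      (maxModule N (k' - 1)).numMatched LS L X D + 1 = k' ∧
        ((maxModule N (k' - 1)).numWrong LS L X D : ℝ)
          ≤ β * ((maxModule N (k' - 1)).numMatched LS L X D : ℝ))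
    have hunion : channelProb n β (fun X D =>
        ¬ ((maxModule N (k' - 1)).numMatched LS L X D + 1 = k' ∧
        ((maxModule N (k' - 1)).numWrong LS L X D : ℝ)
          ≤ β * ((maxModule N (k' - 1)).numMatched LS L X D : ℝ))) ≤
        Real.exp (-(N * (β ^ 2) ^ 2 / 4)) +
          (Real.exp (N * (Real.exp 1 * b * ((1 - 1 / 10)⁻¹) ^ 2) - β / 2 * N) +
            Real.exp (-(N * (β / 8) ^ 2 / 4))) := by
      refine (channelProb_le_add hβ0.le hβle (F := fun X D =>
        ((matchedSet (answer LS L N X D)).card : ℝ) ≤ (1 - q - β ^ 2) * N) (G := fun X D =>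
          β / 2 * N ≤ ((Finset.univ.filter (fun i : Fin N => StrayAt LS L N X D i)).card : ℝ) ∨
          (β / 8 + β / 8) * N ≤
            ((Finset.univ.filter (fun i : Fin N => 2 ≤ pivotDeletions LS L D i)).card : ℝ))
        ?_).trans (add_le_add hf1 ((channelProb_le_add hβ0.le hβle
          fun X D h => h).trans (add_le_add hf2 hf3)))
      intro X D
      contrapose!
      rintro ⟨h1, h2, h3⟩
      -- Here `k' - 1 ≤ ρ * k - 1 ≤ ρ * N`, because `N = k - 1` and `ρ ≤ 1`.
      have hKm : k' - 1 ≤ (matchedSet (answer LS L N X D)).card := by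
        have : ((k' - 1 : ℕ) : ℝ) ≤ ((matchedSet (answer LS L N X D)).card : ℝ) := by
          refine le_trans ?_ h1.le
          rw [hK, hNk, ← hρ]
          linarith
        exact_mod_cast this
      rw [numMatched_maxModule hKm]
      refine ⟨by omega, ?_⟩
      have hw : ((maxModule N (k' - 1)).numWrong LS L X D : ℝ) ≤
          ((Finset.univ.filter (fun i : Fin N => StrayAt LS L N X D i)).card : ℝ) +
          ((Finset.univ.filter (fun i : Fin N => 2 ≤ pivotDeletions LS L D i)).card : ℝ) := by
        exact_mod_cast numWrong_maxModule_le X D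
      -- Fewer than `β / 2 * N` strays and fewer than `β / 4 * N` pivots with two deletions make
      -- fewer than `3 / 4 * β * N` errors, hence at most `β * (k' - 1)`.
      have hKN : 3 / 4 * (N : ℝ) ≤ ((k' - 1 : ℕ) : ℝ) := by
        rw [hK, hNk]
        linarith
      have : β * (3 / 4 * (N : ℝ)) ≤ β * ((k' - 1 : ℕ) : ℝ) := by gcongr
      linarith
    have hfail := failure_bounds_le hβ0 hβ1 (by positivity) hNn hn
    linarith
  · have h1 := channelProb_strayAt_le hl hβ0 hβle hrange (by linarith) ha hbbound
      (by rw [hb]; linarith) i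
    have h2 := channelProb_two_le_pivotDeletions_le (n := n) (LS := LS) hβ0 hβle
      (show 1 ≤ L by omega) hqL i
    refine (channelProb_le_add hβ0.le hβle
      (fun X D h => strayAt_or_of_wrongAt h)).trans ?_
    have h3 : b * ((1 - (b + (1 / 10) ^ 2))⁻¹) ^ 2 ≤ b * 2 := by
      gcongr
      have h5 : (1 - (b + (1 / 10) ^ 2))⁻¹ ≤ (9 / 10)⁻¹ := by
        apply inv_anti₀ (by norm_num)
        rw [hb]
        linarith
      calc ((1 - (b + (1 / 10) ^ 2))⁻¹) ^ 2 ≤ ((9 / 10 : ℝ)⁻¹) ^ 2 := by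
            gcongr
            refine inv_nonneg.mpr ?_
            rw [hb]
            linarith
        _ ≤ 2 := by norm_num
    have : b * 2 ≤ β / 2 := by
      rw [hb]
      linarith
    linarith

/-! ### Consequences of the bounds on the pivot length, and the theorem. -/

theorem half_pow_le_of_logb_le {β : ℝ} (hβ : 0 < β) {m : ℕ} {a : ℝ}
    (h : a + Real.logb 2 (1 / β) ≤ m) : (1 / 2 : ℝ) ^ m ≤ (2 : ℝ) ^ (-a) * β := by
  have e : (1 / 2 : ℝ) ^ m = (2 : ℝ) ^ (-(m : ℝ)) := by
    rw [Real.rpow_neg (by norm_num), Real.rpow_natCast, one_div, inv_pow]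
  have hlog : Real.logb 2 (1 / β) = -Real.logb 2 β := by
    rw [one_div, Real.logb_inv]
  calc (1 / 2 : ℝ) ^ m = (2 : ℝ) ^ (-(m : ℝ)) := e
    _ ≤ (2 : ℝ) ^ (-a + Real.logb 2 β) :=
        Real.rpow_le_rpow_of_exponent_le (by norm_num) (by linarith)
    _ = (2 : ℝ) ^ (-a) * β := by
        rw [Real.rpow_add (by norm_num), Real.rpow_logb (by norm_num) (by norm_num) hβ]

/-- This turns the upper bound on the pivot length into the smallness of `(L + 2) * √β`, uniformly
over the admissible lengths. -/
theorem tendsto_logb_mul_sqrt (C : ℝ) :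
    Tendsto (fun β : ℝ => (C * Real.logb 2 (1 / β) + 2) * Real.sqrt β) (𝓝[>] 0) (𝓝 0) := by
  have h1 : Tendsto (fun β : ℝ => Real.log β * β ^ (1 / 2 : ℝ)) (𝓝[>] 0) (𝓝 0) :=
    tendsto_log_mul_rpow_nhdsGT_zero (by norm_num)
  have h2 : Tendsto (fun β : ℝ => Real.sqrt β) (𝓝[>] 0) (𝓝 0) := by
    have := (Real.continuous_sqrt.tendsto 0).mono_left (nhdsWithin_le_nhds (s := Set.Ioi 0))
    simpa using this
  have h3 := (h1.const_mul (-C / Real.log 2)).add (h2.const_mul 2)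
  simp only [mul_zero, add_zero] at h3
  refine h3.congr fun β => ?_
  rw [← Real.sqrt_eq_rpow, one_div, Real.logb_inv, Real.logb]
  ring

end PivotMatching

theorem theorem2 (C : ℝ) :
    ∃ g e : ℝ → ℝ, g =o[𝓝[>] 0] (fun β : ℝ => β) ∧ e =o[𝓝[>] 0] (fun β : ℝ => β) ∧
    ∃ β₀ : ℝ, 0 < β₀ ∧ ∀ β : ℝ, 0 < β → β < β₀ →
    ∃ c : ℝ, 0 < c ∧ ∃ n₀ : ℕ, ∀ LP n : ℕ,
      11 + 2 * Real.logb 2 (1 / β) ≤ (LP : ℝ) →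
      (LP : ℝ) ≤ C * Real.logb 2 (1 / β) →
      n₀ ≤ n →
      ∃ (k' : ℕ) (M : MatchingModule (numSegments n (segLength β) LP - 1)),
        |(k' : ℝ) - (1 - LP * β + 2 * β) * (numSegments n (segLength β) LP : ℝ)|
            ≤ g β * (numSegments n (segLength β) LP : ℝ) ∧
        1 - (2 : ℝ) ^ (-(c * (n : ℝ))) ≤
          channelProb n β (fun X D =>
            M.numMatched (segLength β) LP X D + 1 = k' ∧
            (M.numWrong (segLength β) LP X D : ℝ)
              ≤ (β + e β) * (M.numMatched (segLength β) LP X D : ℝ)) ∧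
        ∀ i, channelProb n β (fun X D => M.WrongAt (segLength β) LP X D i) ≤ β + e β := by
  -- The constants leave enough room for `e = 0`; the error in `k'`, of order `L * β ^ 2`, fits into
  -- `g = β * √β`.
  refine ⟨fun β => β * Real.sqrt β, fun _ => 0, ?_, isLittleO_zero _ _, ?_⟩
  · have h : (fun β : ℝ => Real.sqrt β) =o[𝓝[>] 0] (fun _ : ℝ => (1 : ℝ)) := by
      rw [isLittleO_one_iff]
      have := (Real.continuous_sqrt.tendsto 0).mono_left (nhdsWithin_le_nhds (s := Set.Ioi 0))
      simpa using this
    simpa using (isBigO_refl (fun β : ℝ => β) (𝓝[>] 0)).mul_isLittleO h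
  · have hev := (PivotMatching.tendsto_logb_mul_sqrt C).eventually
      (gt_mem_nhds (show (0 : ℝ) < 1 / 15000 by norm_num))
    obtain ⟨u, hu0, hu⟩ := mem_nhdsGT_iff_exists_Ioo_subset.mp hev
    refine ⟨min u 1, lt_min hu0 one_pos, fun β hβ0 hβ => ?_⟩
    refine ⟨β ^ 5 / 32, by positivity, ⌈64 / β ^ 5⌉₊, fun L n hL1 hL2 hn => ?_⟩
    have hlog : 0 ≤ Real.logb 2 (1 / β) := by
      apply Real.logb_nonneg (by norm_num)
      rw [le_div_iff₀ hβ0]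
      linarith [hβ.trans_le (min_le_right u 1)]
    have hsmall : ((L : ℝ) + 2) * Real.sqrt β ≤ 1 / 15000 := by
      have h1 : (C * Real.logb 2 (1 / β) + 2) * Real.sqrt β < 1 / 15000 :=
        hu ⟨hβ0, hβ.trans_le (min_le_left u 1)⟩
      refine le_trans ?_ h1.le
      gcongr
    have hL11 : 11 ≤ L := by
      have : (11 : ℝ) ≤ L := by linarith
      exact_mod_cast this
    have hhalf : (1 / 2 : ℝ) ^ (L / 2) ≤ β := by
      have h1 : ((L : ℝ) - 1) / 2 ≤ ((L / 2 : ℕ) : ℝ) := by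
        have : L ≤ 2 * (L / 2) + 1 := by omega
        have : (L : ℝ) ≤ 2 * ((L / 2 : ℕ) : ℝ) + 1 := by exact_mod_cast this
        linarith
      have := PivotMatching.half_pow_le_of_logb_le hβ0 (m := L / 2) (a := 0) (by linarith)
      simpa using this
    have hpow : (1 / 2 : ℝ) ^ L ≤ β ^ 2 / 2048 := by
      have h1 : Real.logb 2 (1 / β ^ 2) = 2 * Real.logb 2 (1 / β) := by
        rw [← one_div_pow, Real.logb_pow]
        norm_num
      have := PivotMatching.half_pow_le_of_logb_le (β := β ^ 2) (by positivity) (m := L) (a := 11)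
        (by rw [h1]; exact hL1)
      calc (1 / 2 : ℝ) ^ L ≤ (2 : ℝ) ^ (-(11 : ℝ)) * β ^ 2 := this
        _ = β ^ 2 / 2048 := by
            rw [Real.rpow_neg (by norm_num), show (11 : ℝ) = ((11 : ℕ) : ℝ) by norm_num,
              Real.rpow_natCast]
            norm_num
            ring
    have hn' : 64 / β ^ 5 ≤ (n : ℝ) := Nat.ceil_le.mp hn
    simpa only [add_zero] using
      PivotMatching.exists_good_module hβ0 (by omega) hsmall hpow hhalf hn'
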